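/- **Setting.** Let $0<\alpha<1$, $\theta=\alpha/2$, $T>0$, $\Omega=(x_l,x_r)\times(y_l,y_r)$. Consider the sub-diffusion problem $\mathcal D_t^\alpha u=a_1u_{xx}+a_2u_{yy}+b_1u_x+b_2u_y+b_3u+f$ in $\Omega\times(0,T]$ (Caputo derivative), $u(\cdot,0)=\varphi$ in $\Omega$, $u=0$ on $\partial\Omega$, with real coefficients depending on $(x,y,t)$. *Condition V1.* For $(x,y)\in\Omega$ and $t\in[0,T]$: $a_1,a_2>0$, $a_1,a_2$ are $C^1$ in $t\in[0,T]$, and $|(a_1)_t/a_1|+|(a_2)_t/a_2|\le C_p$ for a constant $C_p>0$. *Auxiliary functions.* Let $d$ be a positive continuous function on $\Omega$ and put $$p=\frac{d\,e^{-C_pt}}{a_1a_2},\quad p_1=\frac{d\,e^{-C_pt}}{a_2},\quad p_2=\frac{d\,e^{-C_pt}}{a_1},\quad p_3=b_1-p^{-1}(p_1)_x,\quad p_4=b_2-p^{-1}(p_2)_y,$$ where $(p_1)_x$ and $(p_2)_y$ are assumed to exist in $\Omega\times[0,T]$. Let $K$ denote a set of constants with $0<\tilde C_l\le|p_l|\le\hat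 C_l$ for $l=0,1,2$ (where $p_0:=p$), $|p_3|\le\hat C_3$, $|p_4|\le\hat C_4$ and $|b_3|\le \hat C_5$ in $\Omega\times[0,T]$. *Time mesh and Alikhanov formula.* Let $0=t_0<t_1<\dots<t_N=T$, $\tau_k=t_k-t_{k-1}$, $\rho_k=\tau_k/\tau_{k+1}$, $t_{n-\theta}=(1-\theta)t_n+\theta t_{n-1}$, $\omega_\mu(s)=s^{\mu-1}/\Gamma(\mu)$, and $$a^{(n)}_{n-k}=\frac1{\tau_k}\int_{t_{k-1}}^{\min\{t_k,t_{n-\theta}\}}\omega_{1-\alpha}(t_{n-\theta}-s)\,ds\quad(1\le k\le n),$$ $$b^{(n)}_{n-k}=\frac{2}{\tau_k(\tau_k+\tau_{k+1})}\int_{t_{k-1}}^{t_k}\omega_{1-\alpha}(t_{n-\theta}-s)\Bigl(s-\frac{t_{k-1}+t_k}2\Bigr)ds\quad(1\le k\le n-1).$$ Put $A^{(n)}_{n-k}=a^{(n)}_{n-k}+\rho_{k-1}b^{(n)}_{n-k+1}-b^{(n)}_{n-k}$ for $1\le k\le n$, where the term with $\rho_{k-1}$ is omitted if $k=1$ and the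 last term is omitted if $k=n$. Let $(\mathcal D^\alpha_\tau g)^{n-\theta}=\sum_{k=1}^nA^{(n)}_{n-k}(g^k-g^{k-1})$. The complementary kernels are $P^{(n)}_0=1/A^{(n)}_0$ and $P^{(n)}_{n-j}=\frac1{A^{(j)}_0}\sum_{k=j+1}^n\bigl(A^{(k)}_{k-j-1}-A^{(k)}_{k-j}\bigr)P^{(n)}_{n-k}$ for $1\le j\le n-1$. *Scheme.* For positive integers $M_x,M_y$ let $h_x=(x_r-x_l)/M_x$, $h_y=(y_r-y_l)/M_y$, $x_i=x_l+ih_x$, $y_j=y_l+jh_y$, let $\Omega_h$ be the set of grid points $(x_i,y_j)$ with $1\le i\le M_x-1$, $1\le j\le M_y-1$, and put $\delta_xu_{i+1/2,j}=(u_{i+1,j}-u_{i,j})/h_x$, $\delta_{\hat x}u_{i,j}=(u_{i+1,j}-u_{i-1,j})/(2h_x)$, and likewise $\delta_y,\delta_{\hat y}$. With all coefficients evaluated at time $t_{n-\theta}$, let $$\mathcal A_h^{n-\theta}=p^{-1}\{\delta_x[p_1\delta_x]+\delta_y[p_2\delta_y]\}+p_3\delta_{\hat x}+p_4\delta_{\hat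 y}+b_3 .$$ The scheme is $$(\mathcal D_\tau^\alpha u_h)^{n-\theta}=\mathcal A_h^{n-\theta}\bigl[(1-\theta)u_h^n+\theta u_h^{n-1}\bigr]+f_h^{n-\theta}\ \text{ in }\Omega_h,\ 1\le n\le N,\qquad u_h^0=\varphi\ \text{ in }\Omega_h,$$ where every $u_h^n$ vanishes at the boundary grid points, and $f_h^{n-\theta}$ is the grid function equal to $f(\cdot,t_{n-\theta})$ on $\Omega_h$ and to $0$ at the boundary grid points. For a grid function $v$ vanishing at the boundary grid points, $$\|\nabla_hv\|^2=h_xh_y\Bigl[\sum_{i=0}^{M_x-1}\sum_{j=1}^{M_y-1}|\delta_xv_{i+\frac12,j}|^2+\sum_{i=1}^{M_x-1}\sum_{j=0}^{M_y-1}|\delta_yv_{i,j+\frac12}|^2\Bigr].$$ **Theorem.** There is $\tau_0>0$, depending only on $\alpha$, $\Omega$ and $K$, and for every $T>0$ there are constants $C,C'>0$, depending only on $\alpha,\Omega,K$ and $T$, such that the following holds for all coefficients satisfying V1 and the bounds $K$, all $f$ and $\varphi$, all $M_x,M_y\ge1$ and all time meshes with $\rho_k\le 7/4$ for $1\le k\le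 N-1$ and $\max_k\tau_k\le\tau_0$ (no relation between the time steps and $h_x,h_y$ is required). Every solution of the scheme satisfies, for $1\le n\le N$, $$\|\nabla_hu^n\|\le C\Bigl(\|\nabla_hu^0\|+\max_{1\le k\le n}\sum_{j=1}^kP^{(k)}_{k-j}\|\nabla_hf^{j-\theta}\|\Bigr)\le C'\Bigl(\|\nabla_hu^0\|+\max_{1\le k\le n}\bigl\{t_k^\alpha\|\nabla_hf^{k-\theta}\|\bigr\}\Bigr).$$ -/

import Mathlib

noncomputable section

namespace Alikhanov

/-! ### Time meshes, the Alikhanov formula and its complementary kernels -/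

/-- A time mesh `0 = t₀ < t₁ < ⋯ < t_N = T`.  Only the values `t k` with `k ≤ N` matter. -/
structure TimeMesh (T : ℝ) where
  N : ℕ
  t : ℕ → ℝ
  t_zero : t 0 = 0
  t_last : t N = T
  t_lt : ∀ k, k < N → t k < t (k + 1)

namespace TimeMesh

variable {T : ℝ} (m : TimeMesh T)

/-- The step size `τ_k = t_k - t_{k-1}`, for `1 ≤ k ≤ N`. -/
def τ (k : ℕ) : ℝ := m.t k - m.t (k - 1)

/-- The local step ratio `ρ_k = τ_k / τ_{k+1}`, for `1 ≤ k ≤ N - 1`. -/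
def ρ (k : ℕ) : ℝ := m.τ k / m.τ (k + 1)

/-- The off-set point `t_{n-θ} = (1 - θ) t_n + θ t_{n-1}` with `θ = β / 2`, for `n ≥ 1`. -/
def tθ (β : ℝ) (n : ℕ) : ℝ := (1 - β / 2) * m.t n + (β / 2) * m.t (n - 1)

end TimeMesh

/-- The kernel `ω_μ(s) = s^(μ-1) / Γ(μ)`. -/
def ω (μ s : ℝ) : ℝ := s ^ (μ - 1) / Real.Gamma μ

namespace TimeMesh

variable {T : ℝ} (m : TimeMesh T)

/-- `a n k` is `a_{n-k}^{(n)}`, for `1 ≤ k ≤ n`. -/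
def a (β : ℝ) (n k : ℕ) : ℝ :=
  1 / m.τ k * ∫ s in (m.t (k - 1))..(min (m.t k) (m.tθ β n)), ω (1 - β) (m.tθ β n - s)

/-- `b n k` is `b_{n-k}^{(n)}`, for `1 ≤ k ≤ n - 1`; here `t_{k-1/2} = (t_{k-1} + t_k) / 2`. -/
def b (β : ℝ) (n k : ℕ) : ℝ :=
  2 / (m.τ k * (m.τ k + m.τ (k + 1))) *
    ∫ s in (m.t (k - 1))..(m.t k), ω (1 - β) (m.tθ β n - s) * (s - (m.t (k - 1) + m.t k) / 2)

/-- `A n k` is the Alikhanov coefficient `A_{n-k}^{(n)}`, for `1 ≤ k ≤ n`: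
`A_{n-k}^{(n)} = a_{n-k}^{(n)} + ρ_{k-1} b_{n-k+1}^{(n)} - b_{n-k}^{(n)}`, where the term with
`ρ_{k-1}` is absent for `k = 1` and the last term is absent for `k = n`. -/
def A (β : ℝ) (n k : ℕ) : ℝ :=
  m.a β n k
    + (if 2 ≤ k then m.ρ (k - 1) * m.b β n (k - 1) else 0)
    - (if k + 1 ≤ n then m.b β n k else 0)

/-- `P n j` is the discrete complementary convolution kernel `P_{n-j}^{(n)}`, for `1 ≤ j ≤ n`:
`P_0^{(n)} = 1 / A_0^{(n)}` and
`P_{n-j}^{(n)} = (1 / A_0^{(j)}) ∑_{k=j+1}^n (A_{k-j-1}^{(k)} - A_{k-j}^{(k)}) P_{n-k}^{(n)}`. -/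
def P (β : ℝ) (n j : ℕ) : ℝ :=
  if n ≤ j then 1 / m.A β n n
  else 1 / m.A β j j *
    ∑ k ∈ (Finset.Ioc j n).attach,
      (m.A β (k : ℕ) (j + 1) - m.A β (k : ℕ) j) * P β n (k : ℕ)
termination_by n - j
decreasing_by
  have := Finset.mem_Ioc.1 k.2
  omega

/-- The discrete Caputo derivative
`(D_τ^β g)^{n-θ} = ∑_{k=1}^n A_{n-k}^{(n)} (g^k - g^{k-1})`. -/
def caputo (β : ℝ) (g : ℕ → ℝ) (n : ℕ) : ℝ :=
  ∑ k ∈ Finset.Icc 1 n, m.A β n k * (g k - g (k - 1))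

end TimeMesh

/-! ### The rectangle, the space grid and the discrete `H¹` seminorm -/

/-- The rectangle `Ω = (x_l, x_r) × (y_l, y_r)`. -/
structure Rectangle where
  xl : ℝ
  xr : ℝ
  yl : ℝ
  yr : ℝ
  x_lt : xl < xr
  y_lt : yl < yr

/-- Membership of the point `(x, y)` in the open rectangle `Ω`. -/
def Rectangle.Mem (R : Rectangle) (x y : ℝ) : Prop :=
  x ∈ Set.Ioo R.xl R.xr ∧ y ∈ Set.Ioo R.yl R.yr

/-- A uniform grid with `Mx` times `My` cells on the rectangle `R`. -/
structure SpaceGrid (R : Rectangle) where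
  Mx : ℕ
  My : ℕ
  Mx_pos : 0 < Mx
  My_pos : 0 < My

namespace SpaceGrid

variable {R : Rectangle} (G : SpaceGrid R)

def hx : ℝ := (R.xr - R.xl) / G.Mx

def hy : ℝ := (R.yr - R.yl) / G.My

/-- The abscissa `x_r = x_l + r h_x`, for an integer or a half-integer `r`. -/
def x (r : ℝ) : ℝ := R.xl + r * G.hx

/-- The ordinate `y_r = y_l + r h_y`, for an integer or a half-integer `r`. -/
def y (r : ℝ) : ℝ := R.yl + r * G.hy

/-- `(i, j)` is the index of an interior grid point, a point of `Ω_h`. -/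
def Interior (i j : ℕ) : Prop := (1 ≤ i ∧ i + 1 ≤ G.Mx) ∧ (1 ≤ j ∧ j + 1 ≤ G.My)

/-- The grid function `u` (indexed by `0 ≤ i ≤ Mx`, `0 ≤ j ≤ My`) vanishes on the boundary. -/
def VanishesOnBoundary (u : ℕ → ℕ → ℝ) : Prop :=
  ∀ i j, i ≤ G.Mx → j ≤ G.My → ¬ G.Interior i j → u i j = 0

open Classical in
/-- The restriction of a function on `Ω` to the interior grid points, as a grid function that
vanishes on the boundary. -/
def restrict (g : ℝ → ℝ → ℝ) (i j : ℕ) : ℝ :=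
  if G.Interior i j then g (G.x i) (G.y j) else 0

/-- `δ_x u` at the point `(i + 1/2, j)`. -/
def δx (u : ℕ → ℕ → ℝ) (i j : ℕ) : ℝ := (u (i + 1) j - u i j) / G.hx

/-- `δ_y u` at the point `(i, j + 1/2)`. -/
def δy (u : ℕ → ℕ → ℝ) (i j : ℕ) : ℝ := (u i (j + 1) - u i j) / G.hy

/-- The centred difference of `u` in `x` at the interior point `(i, j)`. -/
def δxhat (u : ℕ → ℕ → ℝ) (i j : ℕ) : ℝ := (u (i + 1) j - u (i - 1) j) / (2 * G.hx)

/-- The centred difference of `u` in `y` at the interior point `(i, j)`. -/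
def δyhat (u : ℕ → ℕ → ℝ) (i j : ℕ) : ℝ := (u i (j + 1) - u i (j - 1)) / (2 * G.hy)

/-- `‖δ_x u‖`, with the sum over `0 ≤ i ≤ Mx - 1` and `1 ≤ j ≤ My - 1`. -/
def normδx (u : ℕ → ℕ → ℝ) : ℝ :=
  Real.sqrt (G.hx * G.hy * ∑ i ∈ Finset.range G.Mx, ∑ j ∈ Finset.Ico 1 G.My, G.δx u i j ^ 2)

/-- `‖δ_y u‖`, with the sum over `1 ≤ i ≤ Mx - 1` and `0 ≤ j ≤ My - 1`. -/
def normδy (u : ℕ → ℕ → ℝ) : ℝ :=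
  Real.sqrt (G.hx * G.hy * ∑ i ∈ Finset.Ico 1 G.Mx, ∑ j ∈ Finset.range G.My, G.δy u i j ^ 2)

/-- The discrete `H¹` seminorm `‖∇_h u‖` of a grid function vanishing on the boundary. -/
def normGrad (u : ℕ → ℕ → ℝ) : ℝ := Real.sqrt (G.normδx u ^ 2 + G.normδy u ^ 2)

end SpaceGrid

/-! ### Coefficients of the elliptic operator -/

/-- The coefficients of
`𝒜 u = a₁ u_xx + a₂ u_yy + b₁ u_x + b₂ u_y + b₃ u` (functions of `x`, `y`, `t`), with the function
`d(x, y)` and the constant `C_p` that enter the auxiliary functions `p`, `p₁`, `p₂`. -/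
structure Coefficients where
  a₁ : ℝ → ℝ → ℝ → ℝ
  a₂ : ℝ → ℝ → ℝ → ℝ
  b₁ : ℝ → ℝ → ℝ → ℝ
  b₂ : ℝ → ℝ → ℝ → ℝ
  b₃ : ℝ → ℝ → ℝ → ℝ
  d : ℝ → ℝ → ℝ
  Cp : ℝ

namespace Coefficients

variable (c : Coefficients)

def p (x y t : ℝ) : ℝ := c.d x y * Real.exp (-c.Cp * t) / (c.a₁ x y t * c.a₂ x y t)

def p₁ (x y t : ℝ) : ℝ := c.d x y * Real.exp (-c.Cp * t) / c.a₂ x y t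

def p₂ (x y t : ℝ) : ℝ := c.d x y * Real.exp (-c.Cp * t) / c.a₁ x y t

/-- `p₃ = b₁ - p⁻¹ ∂_x p₁`. -/
def p₃ (x y t : ℝ) : ℝ := c.b₁ x y t - (c.p x y t)⁻¹ * deriv (fun x' => c.p₁ x' y t) x

/-- `p₄ = b₂ - p⁻¹ ∂_y p₂`. -/
def p₄ (x y t : ℝ) : ℝ := c.b₂ x y t - (c.p x y t)⁻¹ * deriv (fun y' => c.p₂ x y' t) y

/-- Condition V1 on `Ω × [0, T]`: `a₁` and `a₂` are positive and continuously differentiable in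
time, and `|∂_t a₁ / a₁| + |∂_t a₂ / a₂| ≤ C_p` for the positive constant `C_p`. -/
structure V1 (R : Rectangle) (T : ℝ) : Prop where
  Cp_pos : 0 < c.Cp
  a₁_pos : ∀ x y, R.Mem x y → ∀ t ∈ Set.Icc 0 T, 0 < c.a₁ x y t
  a₂_pos : ∀ x y, R.Mem x y → ∀ t ∈ Set.Icc 0 T, 0 < c.a₂ x y t
  a₁_C1 : ∀ x y, R.Mem x y → ContDiffOn ℝ 1 (fun t => c.a₁ x y t) (Set.Icc 0 T)
  a₂_C1 : ∀ x y, R.Mem x y → ContDiffOn ℝ 1 (fun t => c.a₂ x y t) (Set.Icc 0 T)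
  log_deriv_le : ∀ x y, R.Mem x y → ∀ t ∈ Set.Icc 0 T,
    |derivWithin (fun s => c.a₁ x y s) (Set.Icc 0 T) t / c.a₁ x y t|
      + |derivWithin (fun s => c.a₂ x y s) (Set.Icc 0 T) t / c.a₂ x y t| ≤ c.Cp

/-- What the definition of the scheme presupposes: `d` is positive and continuous, and the
derivatives `∂_x p₁`, `∂_y p₂` exist in `Ω × [0, T]`. -/
structure Admissible (R : Rectangle) (T : ℝ) : Prop where
  d_pos : ∀ x y, R.Mem x y → 0 < c.d x y
  d_cont : ContinuousOn (fun z : ℝ × ℝ => c.d z.1 z.2)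
    (Set.Ioo R.xl R.xr ×ˢ Set.Ioo R.yl R.yr)
  p₁_diff : ∀ x y, R.Mem x y → ∀ t ∈ Set.Icc 0 T, DifferentiableAt ℝ (fun x' => c.p₁ x' y t) x
  p₂_diff : ∀ x y, R.Mem x y → ∀ t ∈ Set.Icc 0 T, DifferentiableAt ℝ (fun y' => c.p₂ x y' t) y

/-- Bounds for a set of coefficients: lower and upper bounds of `p`, `p₁`, `p₂`, and bounds of the
absolute values of `p₃`, `p₄`, `b₃`. -/
structure Bounds where
  lo₀ : ℝ
  hi₀ : ℝ
  lo₁ : ℝ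
  hi₁ : ℝ
  lo₂ : ℝ
  hi₂ : ℝ
  hi₃ : ℝ
  hi₄ : ℝ
  hiB : ℝ
  lo₀_pos : 0 < lo₀
  lo₁_pos : 0 < lo₁
  lo₂_pos : 0 < lo₂

/-- The coefficients obey the bounds `K` in `Ω × [0, T]`. -/
structure BoundedBy (R : Rectangle) (T : ℝ) (K : Bounds) : Prop where
  p_mem : ∀ x y, R.Mem x y → ∀ t ∈ Set.Icc 0 T, |c.p x y t| ∈ Set.Icc K.lo₀ K.hi₀
  p₁_mem : ∀ x y, R.Mem x y → ∀ t ∈ Set.Icc 0 T, |c.p₁ x y t| ∈ Set.Icc K.lo₁ K.hi₁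
  p₂_mem : ∀ x y, R.Mem x y → ∀ t ∈ Set.Icc 0 T, |c.p₂ x y t| ∈ Set.Icc K.lo₂ K.hi₂
  p₃_le : ∀ x y, R.Mem x y → ∀ t ∈ Set.Icc 0 T, |c.p₃ x y t| ≤ K.hi₃
  p₄_le : ∀ x y, R.Mem x y → ∀ t ∈ Set.Icc 0 T, |c.p₄ x y t| ≤ K.hi₄
  b₃_le : ∀ x y, R.Mem x y → ∀ t ∈ Set.Icc 0 T, |c.b₃ x y t| ≤ K.hiB

/-- The discrete elliptic operator at time `t`,
`p⁻¹ {δ_x [p₁ δ_x] + δ_y [p₂ δ_y]} + p₃ δ_x̂ + p₄ δ_ŷ + b₃`, applied to `u` at the interior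
point `(i, j)`. -/
def discreteOp {R : Rectangle} (G : SpaceGrid R) (t : ℝ) (u : ℕ → ℕ → ℝ) (i j : ℕ) : ℝ :=
  (c.p (G.x i) (G.y j) t)⁻¹ *
      ((c.p₁ (G.x (i + 1 / 2)) (G.y j) t * G.δx u i j
          - c.p₁ (G.x (i - 1 / 2)) (G.y j) t * G.δx u (i - 1) j) / G.hx
        + (c.p₂ (G.x i) (G.y (j + 1 / 2)) t * G.δy u i j
          - c.p₂ (G.x i) (G.y (j - 1 / 2)) t * G.δy u i (j - 1)) / G.hy)
    + c.p₃ (G.x i) (G.y j) t * G.δxhat u i j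
    + c.p₄ (G.x i) (G.y j) t * G.δyhat u i j
    + c.b₃ (G.x i) (G.y j) t * u i j

end Coefficients

/-- `u n i j` (`0 ≤ n ≤ N`, `0 ≤ i ≤ Mx`, `0 ≤ j ≤ My`) solves the nonuniform Alikhanov scheme
`(D_τ^α u)^{n-θ} = 𝒜_h^{n-θ} u^{n-θ} + f^{n-θ}` in `Ω_h` for `1 ≤ n ≤ N`, `u^0 = φ` in `Ω_h`, with
zero boundary values, where `θ = α / 2`, `u^{n-θ} = (1 - θ) u^n + θ u^{n-1}` and
`f^{n-θ} = f(·, t_{n-θ})`. -/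
structure IsDiscreteSolution {R : Rectangle} {T : ℝ} (α : ℝ) (c : Coefficients)
    (f : ℝ → ℝ → ℝ → ℝ) (φ : ℝ → ℝ → ℝ) (m : TimeMesh T) (G : SpaceGrid R)
    (u : ℕ → ℕ → ℕ → ℝ) : Prop where
  boundary : ∀ n, n ≤ m.N → G.VanishesOnBoundary (u n)
  initial : ∀ i j, G.Interior i j → u 0 i j = φ (G.x i) (G.y j)
  equation : ∀ n, 1 ≤ n → n ≤ m.N → ∀ i j, G.Interior i j →
    m.caputo α (fun k => u k i j) n
      = c.discreteOp G (m.tθ α n)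
          (fun i' j' => (1 - α / 2) * u n i' j' + (α / 2) * u (n - 1) i' j') i j
        + f (G.x i) (G.y j) (m.tθ α n)

end Alikhanov

end

/-!
The proof is an energy argument that never looks at the continuous problem.

*Coefficients.* For fixed `n` the function `w(s) = ω_{1-α}(t_{n-θ} - s)` is increasing and convex.
Comparing the mean values and first moments of `w` that make up `A_{n-k}^{(n)}` with point values
of `w` gives `w(t_{k-1}) ≤ A_{n-k}^{(n)} ≤ w(t_k)` for `k < n` (`TimeMesh.ω_le_A_of_lt`,
`TimeMesh.A_le_ω`; the upper bound uses `ρ ≤ 7/4`), and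
`(1 - α) A_0^{(n)} ≥ (1 - θ) w(t_{n-1})` (`TimeMesh.ω_le_A_self`). Hence the coefficients are
monotone, with a gap between the two leading ones, and `A_{n-k}^{(n)} ≥ ω_{1-α}(t_n - t_{k-1})`.
Monotonicity makes the complementary kernels nonnegative, and the gap yields the coercivity
`(D v)^{n-θ} v^{n-θ} ≥ (D v²)^{n-θ} / 2` (`TimeMesh.half_caputo_sq_le`).

*Grönwall inequality.* By the pointwise lower bound, `e^{μ t}` is a supersolution on meshes with
steps at most `1 / (2 μ)`: the convolution of the complementary kernels with `e^{μ t_j}` is at most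
`3 e^{μ t_n} / ω_{1-α}(1/μ)` (`TimeMesh.sum_P_mul_exp_le`). As `ω_{1-α}(1/μ)` grows like `μ^α`,
a zero order term `Λ` is absorbed once `μ` is large, depending on `α` and `Λ` only
(`TimeMesh.le_of_caputo_sq_le`). The same lower bound gives `∑_j P_{n-j}^{(n)} ω_{1-α}(t_j) ≤ 1`
(`TimeMesh.sum_P_mul_ω_le`), from which the second inequality of the theorem follows.

*Energy.* The scheme is tested with `δ_x [p₁ δ_x v] + δ_y [p₂ δ_y v]`, `v = u^{n-θ}`; the factor
`p⁻¹` makes the elliptic term a square that absorbs the lower order terms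
(`Coefficients.sum_edgeWeight_mul_grad_le`). On the left appears the discrete Caputo derivative of
the gradient with the weights `p₁`, `p₂` frozen at `t_{n-θ}`. By condition V1 these weights decrease
in time, so that freezing them only helps (`TimeMesh.caputo_weight_le`), and the weighted energies
at the times `t_{k-θ}` satisfy the hypothesis of the Grönwall inequality.
-/

/-! ### The kernel `ω` -/

namespace Alikhanov

theorem convexOn_rpow_neg {α : ℝ} (hα : 0 ≤ α) :
    ConvexOn ℝ (Set.Ioi 0) (fun x : ℝ => x ^ (-α)) := by
  refine ⟨convex_Ioi 0, fun x hx y hy a b ha hb hab => ?_⟩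
  have hx' : 0 < x := hx
  have hy' : 0 < y := hy
  have hz : 0 < a • x + b • y := convex_Ioi 0 hx hy ha hb hab
  have hlog := strictConcaveOn_log_Ioi.concaveOn.2 hx hy ha hb hab
  have hexp := convexOn_exp.2 (Set.mem_univ (Real.log x * -α)) (Set.mem_univ (Real.log y * -α))
    ha hb hab
  simp only [smul_eq_mul] at *
  rw [Real.rpow_def_of_pos hx', Real.rpow_def_of_pos hy', Real.rpow_def_of_pos hz]
  refine le_trans (Real.exp_le_exp.2 ?_) hexp
  nlinarith [mul_le_mul_of_nonneg_right hlog hα]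

variable {α : ℝ}

theorem ω_one_sub (α s : ℝ) : ω (1 - α) s = s ^ (-α) / Real.Gamma (1 - α) := by
  unfold ω
  congr 2
  ring

theorem gamma_one_sub_pos (hα : α ∈ Set.Ioo (0 : ℝ) 1) : 0 < Real.Gamma (1 - α) :=
  Real.Gamma_pos_of_pos (by linarith [hα.2])

theorem ω_pos (hα : α ∈ Set.Ioo (0 : ℝ) 1) {s : ℝ} (hs : 0 < s) : 0 < ω (1 - α) s := by
  rw [ω_one_sub]
  exact div_pos (Real.rpow_pos_of_pos hs _) (gamma_one_sub_pos hα)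

theorem ω_anti (hα : α ∈ Set.Ioo (0 : ℝ) 1) {s r : ℝ} (hs : 0 < s) (hsr : s ≤ r) :
    ω (1 - α) r ≤ ω (1 - α) s := by
  rw [ω_one_sub, ω_one_sub]
  have := gamma_one_sub_pos hα
  gcongr ?_ / _
  exact Real.rpow_le_rpow_of_nonpos hs hsr (by linarith [hα.1])

theorem convexOn_ω_sub (hα : α ∈ Set.Ioo (0 : ℝ) 1) (c : ℝ) :
    ConvexOn ℝ (Set.Iio c) (fun s => ω (1 - α) (c - s)) := by
  have h := ((convexOn_rpow_neg hα.1.le).smul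
    (inv_nonneg.2 (gamma_one_sub_pos hα).le)).comp_affineMap
      (AffineMap.const ℝ ℝ c - AffineMap.id ℝ ℝ)
  have hset : (AffineMap.const ℝ ℝ c - AffineMap.id ℝ ℝ : ℝ →ᵃ[ℝ] ℝ) ⁻¹' Set.Ioi 0
      = Set.Iio c := by
    ext s
    simp
  rw [hset] at h
  refine h.congr fun s _ => ?_
  simp [ω_one_sub, div_eq_inv_mul]

theorem monotoneOn_ω_sub (hα : α ∈ Set.Ioo (0 : ℝ) 1) (c : ℝ) :
    MonotoneOn (fun s => ω (1 - α) (c - s)) (Set.Iio c) := fun s _ r hr hsr =>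
  ω_anti hα (sub_pos.2 hr) (by linarith)

theorem continuousOn_ω_sub (hα : α ∈ Set.Ioo (0 : ℝ) 1) (c : ℝ) :
    ContinuousOn (fun s => ω (1 - α) (c - s)) (Set.Iio c) :=
  (convexOn_ω_sub hα c).continuousOn isOpen_Iio

/-! ### Mean values of monotone and convex functions -/

section MeanValues

variable {f : ℝ → ℝ}

theorem integral_add_mul_sub_midpoint (l r a b : ℝ) :
    ∫ s in l..r, (a + b * (s - (l + r) / 2)) = a * (r - l) := by
  rw [intervalIntegral.integral_add (by simp)
    (Continuous.intervalIntegrable (by fun_prop) _ _), intervalIntegral.integral_const,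
    intervalIntegral.integral_const_mul, intervalIntegral.integral_sub (by simp) (by simp),
    integral_id, intervalIntegral.integral_const]
  simp only [smul_eq_mul]
  ring

/-- The weight `1 - 2 (s - (l + r) / 2) / (r - l + τ')` is nonnegative on `[l, r]` and has mean
value one, so that the weighted mean of an increasing function is at least its value at `l`. -/
theorem left_le_mean_sub_moment {l r τ' : ℝ} (hlr : l < r) (hτ' : 0 < τ')
    (hmono : MonotoneOn f (Set.Icc l r)) (hcont : ContinuousOn f (Set.Icc l r)) :
    f l ≤ 1 / (r - l) * (∫ s in l..r, f s)
      - 2 / ((r - l) * ((r - l) + τ')) * ∫ s in l..r, f s * (s - (l + r) / 2) := by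
  have hh : 0 < r - l := sub_pos.2 hlr
  have hk : 0 < (r - l) + τ' := by linarith
  have hcu : ContinuousOn f (Set.uIcc l r) := by rwa [Set.uIcc_of_le hlr.le]
  have hi : IntervalIntegrable f MeasureTheory.volume l r := hcu.intervalIntegrable
  have hi2 : IntervalIntegrable (fun s => f s * (s - (l + r) / 2)) MeasureTheory.volume l r :=
    (hcu.mul (by fun_prop)).intervalIntegrable
  have key : ∫ s in l..r, (f l + (-(2 / ((r - l) + τ')) * f l) * (s - (l + r) / 2))
      ≤ ∫ s in l..r, (f s - 2 / ((r - l) + τ') * (f s * (s - (l + r) / 2))) := by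
    refine intervalIntegral.integral_mono_on hlr.le
      (Continuous.intervalIntegrable (by fun_prop) _ _) (hi.sub (hi2.const_mul _)) fun s hs => ?_
    have h1 : f l ≤ f s := hmono ⟨le_rfl, hlr.le⟩ hs hs.1
    have h2 : 0 ≤ 1 - 2 / ((r - l) + τ') * (s - (l + r) / 2) := by
      rw [sub_nonneg, div_mul_eq_mul_div, div_le_one hk]
      linarith [hs.2]
    nlinarith [mul_nonneg (sub_nonneg.2 h1) h2]
  rw [integral_add_mul_sub_midpoint, intervalIntegral.integral_sub hi (hi2.const_mul _),
    intervalIntegral.integral_const_mul] at key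
  have e : 1 / (r - l) * (∫ s in l..r, f s)
      - 2 / ((r - l) * ((r - l) + τ')) * (∫ s in l..r, f s * (s - (l + r) / 2))
      = ((∫ s in l..r, f s) - 2 / ((r - l) + τ') * ∫ s in l..r, f s * (s - (l + r) / 2))
        / (r - l) := by
    field_simp
  rw [e, le_div_iff₀ hh]
  exact key

/-- The right half of the Hermite–Hadamard inequality. -/
theorem integral_le_trapezoid {l r : ℝ} (hlr : l < r) (hconv : ConvexOn ℝ (Set.Icc l r) f)
    (hcont : ContinuousOn f (Set.Icc l r)) :
    ∫ s in l..r, f s ≤ (f l + f r) / 2 * (r - l) := by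
  have hh : 0 < r - l := sub_pos.2 hlr
  have hcu : ContinuousOn f (Set.uIcc l r) := by rwa [Set.uIcc_of_le hlr.le]
  rw [← integral_add_mul_sub_midpoint l r _ ((f r - f l) / (r - l))]
  refine intervalIntegral.integral_mono_on hlr.le hcu.intervalIntegrable
    (Continuous.intervalIntegrable (by fun_prop) _ _) fun s hs => ?_
  have h := hconv.2 (Set.left_mem_Icc.2 hlr.le) (Set.right_mem_Icc.2 hlr.le)
    (div_nonneg (sub_nonneg.2 hs.2) hh.le) (div_nonneg (sub_nonneg.2 hs.1) hh.le)
    (by field_simp; ring)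
  simp only [smul_eq_mul] at h
  have e : (r - s) / (r - l) * l + (s - l) / (r - l) * r = s := by
    field_simp
    ring
  rw [e] at h
  refine h.trans (le_of_eq ?_)
  field_simp
  ring

theorem integral_moment_nonneg {l r : ℝ} (hlr : l < r)
    (hmono : MonotoneOn f (Set.Icc l r)) (hcont : ContinuousOn f (Set.Icc l r)) :
    0 ≤ ∫ s in l..r, f s * (s - (l + r) / 2) := by
  have hcu : ContinuousOn f (Set.uIcc l r) := by rwa [Set.uIcc_of_le hlr.le]
  have hm : (l + r) / 2 ∈ Set.Icc l r := ⟨by linarith, by linarith⟩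
  have h0 := integral_add_mul_sub_midpoint l r 0 (f ((l + r) / 2))
  simp only [zero_add, zero_mul] at h0
  rw [← h0]
  refine intervalIntegral.integral_mono_on hlr.le
    (Continuous.intervalIntegrable (by fun_prop) _ _)
    (hcu.mul (by fun_prop)).intervalIntegrable fun s hs => ?_
  rcases le_total s ((l + r) / 2) with h | h
  · nlinarith [hmono hs hm h]
  · nlinarith [hmono hm hs h]

theorem integral_moment_le {l r G : ℝ} (hlr : l < r) (hcont : ContinuousOn f (Set.Icc l r))
    (hG : ∀ s ∈ Set.Icc l r, ∀ s' ∈ Set.Icc l r, s ≤ s' → f s' - f s ≤ G * (s' - s)) :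
    ∫ s in l..r, f s * (s - (l + r) / 2) ≤ G * (r - l) ^ 3 / 12 := by
  have hcu : ContinuousOn f (Set.uIcc l r) := by rwa [Set.uIcc_of_le hlr.le]
  have hi2 : IntervalIntegrable (fun s => f s * (s - (l + r) / 2)) MeasureTheory.volume l r :=
    (hcu.mul (by fun_prop)).intervalIntegrable
  have hm : (l + r) / 2 ∈ Set.Icc l r := ⟨by linarith, by linarith⟩
  have key : ∫ s in l..r, f s * (s - (l + r) / 2)
      ≤ ∫ s in l..r, (f ((l + r) / 2) * (s - (l + r) / 2) + G * (s - (l + r) / 2) ^ 2) := by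
    refine intervalIntegral.integral_mono_on hlr.le hi2
      (Continuous.intervalIntegrable (by fun_prop) _ _) fun s hs => ?_
    rcases le_total s ((l + r) / 2) with h | h
    · nlinarith [hG s hs _ hm h]
    · nlinarith [hG _ hm s hs h]
  refine key.trans (le_of_eq ?_)
  have h0 := integral_add_mul_sub_midpoint l r 0 (f ((l + r) / 2))
  simp only [zero_add, zero_mul] at h0
  rw [intervalIntegral.integral_add (Continuous.intervalIntegrable (by fun_prop) _ _)
    (Continuous.intervalIntegrable (by fun_prop) _ _), h0, intervalIntegral.integral_const_mul,
    intervalIntegral.integral_comp_sub_right (fun s => s ^ 2), integral_pow]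
  push_cast
  ring

/-- For a convex function, the excess of the right end value over the mean on `[l, r]` dominates
the first moment over the preceding interval `[l₀, l]`, as long as the length ratio `ρ` of the
two intervals is at most `7 / 4`; the argument needs `ρ ^ 3 ≤ 3 * (1 + ρ)`. -/
theorem mean_add_moment_le_right {l₀ l r : ℝ} (h₀ : l₀ < l) (hlr : l < r)
    (hρ : (l - l₀) / (r - l) ≤ 7 / 4)
    (hmono : MonotoneOn f (Set.Icc l₀ r)) (hconv : ConvexOn ℝ (Set.Icc l₀ r) f)
    (hcont : ContinuousOn f (Set.Icc l₀ r)) :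
    1 / (r - l) * (∫ s in l..r, f s)
      + (l - l₀) / (r - l) * (2 / ((l - l₀) * ((l - l₀) + (r - l)))
          * ∫ s in l₀..l, f s * (s - (l₀ + l) / 2)) ≤ f r := by
  have hh : 0 < l - l₀ := sub_pos.2 h₀
  have hk : 0 < r - l := sub_pos.2 hlr
  have hsubL : Set.Icc l₀ l ⊆ Set.Icc l₀ r := Set.Icc_subset_Icc_right hlr.le
  have hsubR : Set.Icc l r ⊆ Set.Icc l₀ r := Set.Icc_subset_Icc_left h₀.le
  have hR := integral_le_trapezoid hlr (hconv.subset hsubR (convex_Icc _ _)) (hcont.mono hsubR)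
  set G := (f r - f l) / (r - l) with hGdef
  have hG0 : 0 ≤ G := div_nonneg
    (sub_nonneg.2 (hmono (hsubR ⟨le_rfl, hlr.le⟩) (hsubR ⟨hlr.le, le_rfl⟩) hlr.le)) hk.le
  have hslope : ∀ s ∈ Set.Icc l₀ l, ∀ s' ∈ Set.Icc l₀ l, s ≤ s' →
      f s' - f s ≤ G * (s' - s) := by
    intro s hs s' hs' hss
    rcases hss.eq_or_lt with rfl | hlt
    · simp
    have hrm : r ∈ Set.Icc l₀ r := ⟨by linarith, le_rfl⟩
    have h1 := hconv.secant_mono (hsubL hs') (hsubL hs) hrm hlt.ne (by linarith [hs'.2])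
      (by linarith [hs.2])
    have h2 := hconv.secant_mono hrm (hsubL hs') (hsubR ⟨le_rfl, hlr.le⟩)
      (by linarith [hs'.2]) hlr.ne hs'.2
    have h3 : (f l - f r) / (l - r) = G := by
      rw [hGdef, ← neg_sub (f r), ← neg_sub r, neg_div_neg_eq]
    have h4 : (f s' - f r) / (s' - r) = (f r - f s') / (r - s') := by
      rw [← neg_sub (f r), ← neg_sub r, neg_div_neg_eq]
    have h5 : (f s - f s') / (s - s') = (f s' - f s) / (s' - s) := by
      rw [← neg_sub (f s'), ← neg_sub s', neg_div_neg_eq]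
    rw [h3, h4] at h2
    rw [h5] at h1
    exact (div_le_iff₀ (sub_pos.2 hlt)).1 (h1.trans h2)
  have hL := integral_moment_le h₀ (hcont.mono hsubL) hslope
  have hGk : f l = f r - G * (r - l) := by
    rw [hGdef]
    field_simp
    ring
  have h1 : 1 / (r - l) * (∫ s in l..r, f s) ≤ f r - G * (r - l) / 2 := by
    rw [one_div, inv_mul_le_iff₀ hk]
    rw [hGk] at hR
    linarith
  have h2 : (l - l₀) / (r - l) * (2 / ((l - l₀) * ((l - l₀) + (r - l)))
          * ∫ s in l₀..l, f s * (s - (l₀ + l) / 2)) ≤ G * (r - l) / 2 := by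
    have e : (l - l₀) / (r - l) * (2 / ((l - l₀) * ((l - l₀) + (r - l)))
          * ∫ s in l₀..l, f s * (s - (l₀ + l) / 2))
        = 2 * (∫ s in l₀..l, f s * (s - (l₀ + l) / 2))
          / ((r - l) * ((l - l₀) + (r - l))) := by
      field_simp
    rw [e, div_le_iff₀ (by positivity)]
    rw [div_le_iff₀ hk] at hρ
    generalize l - l₀ = h at *
    generalize r - l = k at *
    have hp : h ^ 3 ≤ 3 * k ^ 2 * (h + k) := by
      nlinarith [mul_nonneg hh.le (mul_nonneg (sub_nonneg.2 hρ)
        (by positivity : (0 : ℝ) ≤ h + 7 / 4 * k)), pow_pos hk 3, mul_pos hh (pow_pos hk 2)]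
    nlinarith [mul_le_mul_of_nonneg_left hp hG0]
  linarith

end MeanValues

end Alikhanov

namespace Alikhanov

/-! ### Bounds for the Alikhanov coefficients -/

namespace TimeMesh

variable {T : ℝ} {m : TimeMesh T} {α : ℝ}

theorem t_strictMono {j k : ℕ} (hjk : j < k) (hk : k ≤ m.N) : m.t j < m.t k := by
  induction k, hjk using Nat.le_induction with
  | base => exact m.t_lt j (by omega)
  | succ k hjk ih => exact (ih (by omega)).trans (m.t_lt k (by omega))

theorem t_mono {j k : ℕ} (hjk : j ≤ k) (hk : k ≤ m.N) : m.t j ≤ m.t k := by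
  rcases hjk.eq_or_lt with rfl | h
  · rfl
  · exact (t_strictMono h hk).le

theorem t_nonneg {k : ℕ} (hk : k ≤ m.N) : 0 ≤ m.t k :=
  m.t_zero.symm.le.trans (t_mono (Nat.zero_le k) hk)

theorem t_pos {k : ℕ} (h1 : 1 ≤ k) (hk : k ≤ m.N) : 0 < m.t k :=
  m.t_zero.symm.le.trans_lt (t_strictMono h1 hk)

theorem τ_pos {k : ℕ} (h1 : 1 ≤ k) (hk : k ≤ m.N) : 0 < m.τ k :=
  sub_pos.2 (t_strictMono (by omega) hk)

theorem lt_tθ (hα : α ∈ Set.Ioo (0 : ℝ) 1) {n : ℕ} (h1 : 1 ≤ n) (hn : n ≤ m.N) :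
    m.t (n - 1) < m.tθ α n := by
  have := t_strictMono (m := m) (show n - 1 < n by omega) hn
  unfold tθ
  nlinarith [hα.2]

theorem tθ_le (hα : α ∈ Set.Ioo (0 : ℝ) 1) {n : ℕ} (hn : n ≤ m.N) : m.tθ α n ≤ m.t n := by
  have := t_mono (m := m) (show n - 1 ≤ n by omega) hn
  unfold tθ
  nlinarith [hα.1]

theorem lt_tθ_of_lt (hα : α ∈ Set.Ioo (0 : ℝ) 1) {k n : ℕ} (hkn : k < n) (hn : n ≤ m.N) :
    m.t k < m.tθ α n :=
  (t_mono (by omega) (by omega)).trans_lt (lt_tθ hα (by omega) hn)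

theorem tθ_sub (n : ℕ) : m.tθ α n - m.t (n - 1) = (1 - α / 2) * m.τ n := by
  unfold tθ τ
  ring

theorem Icc_subset_Iio_tθ (hα : α ∈ Set.Ioo (0 : ℝ) 1) {j k n : ℕ} (hkn : k < n)
    (hn : n ≤ m.N) : Set.Icc (m.t j) (m.t k) ⊆ Set.Iio (m.tθ α n) := fun _ hs =>
  hs.2.trans_lt (lt_tθ_of_lt hα hkn hn)

theorem b_nonneg (hα : α ∈ Set.Ioo (0 : ℝ) 1) {k n : ℕ} (hk : 1 ≤ k) (hkn : k < n)
    (hn : n ≤ m.N) : 0 ≤ m.b α n k := by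
  have h1 := τ_pos (m := m) hk (by omega)
  have h2 := τ_pos (m := m) (k := k + 1) (by omega) (by omega)
  have hsub := Icc_subset_Iio_tθ (m := m) hα (j := k - 1) hkn hn
  exact mul_nonneg (by positivity) (integral_moment_nonneg (t_strictMono (by omega) (by omega))
    ((monotoneOn_ω_sub hα _).mono hsub) ((continuousOn_ω_sub hα _).mono hsub))

theorem a_of_lt (hα : α ∈ Set.Ioo (0 : ℝ) 1) {k n : ℕ} (hkn : k < n)
    (hn : n ≤ m.N) : m.a α n k = 1 / (m.t k - m.t (k - 1)) *
      ∫ s in (m.t (k - 1))..(m.t k), ω (1 - α) (m.tθ α n - s) := by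
  unfold a
  rw [min_eq_left (lt_tθ_of_lt hα hkn hn).le]
  rfl

theorem ω_le_a_sub_b (hα : α ∈ Set.Ioo (0 : ℝ) 1) {k n : ℕ} (hk : 1 ≤ k) (hkn : k < n)
    (hn : n ≤ m.N) : ω (1 - α) (m.tθ α n - m.t (k - 1)) ≤ m.a α n k - m.b α n k := by
  have hsub := Icc_subset_Iio_tθ (m := m) hα (j := k - 1) hkn hn
  rw [a_of_lt hα hkn hn]
  exact left_le_mean_sub_moment (t_strictMono (by omega) (by omega))
    (τ_pos (k := k + 1) (by omega) (by omega))
    ((monotoneOn_ω_sub hα _).mono hsub) ((continuousOn_ω_sub hα _).mono hsub)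

theorem a_add_b_le_ω (hα : α ∈ Set.Ioo (0 : ℝ) 1)
    (hρ : ∀ k, 1 ≤ k → k + 1 ≤ m.N → m.ρ k ≤ 7 / 4) {k n : ℕ} (hk : 2 ≤ k) (hkn : k < n)
    (hn : n ≤ m.N) :
    m.a α n k + m.ρ (k - 1) * m.b α n (k - 1) ≤ ω (1 - α) (m.tθ α n - m.t k) := by
  have hsub := Icc_subset_Iio_tθ (m := m) hα (j := k - 1 - 1) hkn hn
  rw [a_of_lt hα hkn hn]
  have hk1 : k - 1 + 1 = k := by omega
  have h := hρ (k - 1) (by omega) (by omega)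
  unfold ρ τ at h
  rw [hk1] at h
  unfold ρ b τ
  rw [hk1]
  exact mean_add_moment_le_right (t_strictMono (by omega) (by omega))
    (t_strictMono (by omega) (by omega)) h ((monotoneOn_ω_sub hα _).mono hsub)
    ((convexOn_ω_sub hα _).subset hsub (convex_Icc _ _)) ((continuousOn_ω_sub hα _).mono hsub)

theorem a_le_ω (hα : α ∈ Set.Ioo (0 : ℝ) 1) {k n : ℕ} (hk : 1 ≤ k) (hkn : k < n)
    (hn : n ≤ m.N) : m.a α n k ≤ ω (1 - α) (m.tθ α n - m.t k) := by
  have hsub := Icc_subset_Iio_tθ (m := m) hα (j := k - 1) hkn hn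
  have hlt : m.t (k - 1) < m.t k := t_strictMono (by omega) (by omega)
  rw [a_of_lt hα hkn hn, one_div, inv_mul_le_iff₀ (sub_pos.2 hlt)]
  refine (integral_le_trapezoid hlt ((convexOn_ω_sub hα _).subset hsub (convex_Icc _ _))
    ((continuousOn_ω_sub hα _).mono hsub)).trans ?_
  have := monotoneOn_ω_sub hα _ (hsub ⟨le_rfl, hlt.le⟩) (hsub ⟨hlt.le, le_rfl⟩) hlt.le
  simp only at this
  nlinarith [sub_pos.2 hlt]

theorem A_le_ω (hα : α ∈ Set.Ioo (0 : ℝ) 1)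
    (hρ : ∀ k, 1 ≤ k → k + 1 ≤ m.N → m.ρ k ≤ 7 / 4) {k n : ℕ} (hk : 1 ≤ k) (hkn : k < n)
    (hn : n ≤ m.N) : m.A α n k ≤ ω (1 - α) (m.tθ α n - m.t k) := by
  have hb := b_nonneg hα hk hkn hn
  unfold A
  rw [if_pos (show k + 1 ≤ n from hkn)]
  split_ifs with h2
  · linarith [a_add_b_le_ω hα hρ h2 hkn hn]
  · linarith [a_le_ω hα hk hkn hn]

theorem ρ_mul_b_nonneg (hα : α ∈ Set.Ioo (0 : ℝ) 1) {k n : ℕ} (hkn : k ≤ n) (hn : n ≤ m.N) :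
    0 ≤ if 2 ≤ k then m.ρ (k - 1) * m.b α n (k - 1) else 0 := by
  split_ifs with h2
  · exact mul_nonneg (div_nonneg (τ_pos (by omega) (by omega)).le
      (τ_pos (by omega) (by omega)).le) (b_nonneg hα (by omega) (by omega) hn)
  · rfl

theorem ω_le_A_of_lt (hα : α ∈ Set.Ioo (0 : ℝ) 1) {k n : ℕ} (hk : 1 ≤ k) (hkn : k < n)
    (hn : n ≤ m.N) : ω (1 - α) (m.tθ α n - m.t (k - 1)) ≤ m.A α n k := by
  have h := ρ_mul_b_nonneg hα hkn.le hn
  have := ω_le_a_sub_b hα hk hkn hn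
  unfold A
  rw [if_pos (show k + 1 ≤ n from hkn)]
  linarith

/-- The leading coefficient is dominated from below by the exactly computable singular integral
`a_0^{(n)} = (1 - θ) / (1 - α) * ω_{1-α}(t_{n-θ} - t_{n-1})`. -/
theorem ω_le_A_self (hα : α ∈ Set.Ioo (0 : ℝ) 1) {n : ℕ} (h1 : 1 ≤ n) (hn : n ≤ m.N) :
    (1 - α / 2) * ω (1 - α) (m.tθ α n - m.t (n - 1)) ≤ (1 - α) * m.A α n n := by
  have h := ρ_mul_b_nonneg hα le_rfl hn
  have hτ := τ_pos (m := m) h1 hn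
  have hα1 : 0 < 1 - α := by linarith [hα.2]
  have hθ : 0 < 1 - α / 2 := by linarith [hα.2]
  have ha : (1 - α) * m.a α n n = (1 - α / 2) * ω (1 - α) (m.tθ α n - m.t (n - 1)) := by
    unfold a
    rw [min_eq_right (tθ_le hα hn)]
    simp only [ω_one_sub]
    rw [intervalIntegral.integral_div,
      intervalIntegral.integral_comp_sub_left (fun s => s ^ (-α)),
      integral_rpow (Or.inl (by linarith [hα.2])), sub_self, tθ_sub,
      Real.zero_rpow (by linarith [hα.2]), Real.rpow_add (by positivity), Real.rpow_one]
    have := (gamma_one_sub_pos hα).ne'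
    have h3 : -α + 1 ≠ 0 := by linarith
    field_simp
    ring
  unfold A
  rw [if_neg (by omega : ¬ n + 1 ≤ n)]
  nlinarith [mul_nonneg hα1.le h]

/-- The pointwise lower bound of the coefficients by the kernel itself; it is the only
quantitative information on the `A_{n-k}^{(n)}` that enters the Grönwall inequality. -/
theorem ω_le_A (hα : α ∈ Set.Ioo (0 : ℝ) 1) {k n : ℕ} (hk : 1 ≤ k) (hkn : k ≤ n)
    (hn : n ≤ m.N) : ω (1 - α) (m.t n - m.t (k - 1)) ≤ m.A α n k := by
  have hlt := lt_tθ_of_lt (m := m) hα (show k - 1 < n by omega) hn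
  have hle := tθ_le (m := m) hα hn
  have h0 : ω (1 - α) (m.t n - m.t (k - 1)) ≤ ω (1 - α) (m.tθ α n - m.t (k - 1)) :=
    ω_anti hα (by linarith) (by linarith)
  refine h0.trans ?_
  rcases hkn.eq_or_lt with rfl | h
  · have h2 := ω_le_A_self hα hk hn
    have h3 := ω_pos hα (sub_pos.2 hlt)
    have hα1 : 0 < 1 - α := by linarith [hα.2]
    refine le_of_mul_le_mul_left (le_trans ?_ h2) hα1
    nlinarith [hα.1]
  · exact ω_le_A_of_lt hα hk h hn

theorem A_pos (hα : α ∈ Set.Ioo (0 : ℝ) 1) {k n : ℕ} (hk : 1 ≤ k) (hkn : k ≤ n)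
    (hn : n ≤ m.N) : 0 < m.A α n k :=
  (ω_pos hα (sub_pos.2 (t_strictMono (by omega) hn))).trans_le (ω_le_A hα hk hkn hn)

/-- The gap between the two leading coefficients; `θ = α / 2`. -/
theorem mul_A_pred_le (hα : α ∈ Set.Ioo (0 : ℝ) 1)
    (hρ : ∀ k, 1 ≤ k → k + 1 ≤ m.N → m.ρ k ≤ 7 / 4) {n : ℕ} (h1 : 1 ≤ n) (hn : n + 1 ≤ m.N) :
    (1 - α / 2) * m.A α (n + 1) n ≤ (1 - α) * m.A α (n + 1) (n + 1) := by
  have h2 := ω_le_A_self hα (by omega) hn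
  have h3 := A_le_ω hα hρ h1 (Nat.lt_succ_self n) hn
  rw [Nat.add_sub_cancel] at h2
  have hθ : 0 < 1 - α / 2 := by linarith [hα.2]
  nlinarith

theorem A_mono (hα : α ∈ Set.Ioo (0 : ℝ) 1)
    (hρ : ∀ k, 1 ≤ k → k + 1 ≤ m.N → m.ρ k ≤ 7 / 4) {k n : ℕ} (hk : 1 ≤ k) (hkn : k < n)
    (hn : n ≤ m.N) : m.A α n k ≤ m.A α n (k + 1) := by
  rcases (Nat.succ_le_of_lt hkn).eq_or_lt with rfl | h
  · have h1 := mul_A_pred_le hα hρ hk hn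
    have h2 := A_pos (m := m) hα hk (Nat.le_succ k) hn
    have hα1 : 0 < 1 - α := by linarith [hα.2]
    refine le_of_mul_le_mul_left (le_trans ?_ h1) hα1
    nlinarith [hα.1]
  · have h2 := ω_le_A_of_lt (m := m) hα (k := k + 1) (by omega) h hn
    exact (A_le_ω hα hρ hk hkn hn).trans h2

/-! ### The complementary kernels -/

theorem P_self (β : ℝ) (n : ℕ) : m.P β n n = 1 / m.A β n n := by
  rw [P, if_pos le_rfl]

theorem A_mul_P (β : ℝ) {j n : ℕ} (hjn : j < n) (hA : m.A β j j ≠ 0) :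
    m.A β j j * m.P β n j
      = ∑ k ∈ Finset.Ioc j n, (m.A β k (j + 1) - m.A β k j) * m.P β n k := by
  rw [P, if_neg (by omega),
    Finset.sum_attach (Finset.Ioc j n) fun k => (m.A β k (j + 1) - m.A β k j) * m.P β n k]
  field_simp

theorem P_nonneg (hα : α ∈ Set.Ioo (0 : ℝ) 1)
    (hρ : ∀ k, 1 ≤ k → k + 1 ≤ m.N → m.ρ k ≤ 7 / 4) {n : ℕ} (hn : n ≤ m.N) (j : ℕ)
    (hj : 1 ≤ j) (hjn : j ≤ n) : 0 ≤ m.P α n j := by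
  have hA := A_pos (m := m) hα hj le_rfl (hjn.trans hn)
  rcases hjn.eq_or_lt with rfl | h
  · rw [P_self]
    positivity
  · refine nonneg_of_mul_nonneg_right ?_ hA
    rw [A_mul_P α h hA.ne']
    refine Finset.sum_nonneg fun k hk => ?_
    obtain ⟨hjk, hkn⟩ := Finset.mem_Ioc.1 hk
    exact mul_nonneg (sub_nonneg.2 (A_mono hα hρ hj hjk (hkn.trans hn)))
      (P_nonneg hα hρ hn k (by omega) hkn)
termination_by n - j

/-- The defining identity of the complementary kernels,
`∑_{j=k}^n P_{n-j}^{(n)} A_{j-k}^{(j)} = 1`. -/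
theorem sum_P_mul_A (hα : α ∈ Set.Ioo (0 : ℝ) 1) {k n : ℕ} (hk : 1 ≤ k) (hkn : k ≤ n)
    (hn : n ≤ m.N) : ∑ j ∈ Finset.Icc k n, m.P α n j * m.A α j k = 1 := by
  have hpos : ∀ j, 1 ≤ j → j ≤ n → m.A α j j ≠ 0 := fun j h1 h2 =>
    (A_pos hα h1 le_rfl (h2.trans hn)).ne'
  refine Nat.decreasingInduction'
    (P := fun k => 1 ≤ k → ∑ j ∈ Finset.Icc k n, m.P α n j * m.A α j k = 1)
    (fun k hkn' _ ih h1 => ?_) hkn (fun h1 => ?_) hk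
  · rw [← ih (by omega), ← Finset.Ioc_insert_left (by omega : k ≤ n),
      Finset.sum_insert (by simp), mul_comm, A_mul_P α hkn' (hpos k h1 hkn'.le),
      ← Finset.sum_add_distrib]
    have e : Finset.Icc (k + 1) n = Finset.Ioc k n := by
      ext
      simp
    rw [e]
    refine Finset.sum_congr rfl fun j _ => ?_
    ring
  · have := hpos n h1 le_rfl
    rw [Finset.Icc_self, Finset.sum_singleton, P_self]
    field_simp

theorem sum_P_mul_caputo (hα : α ∈ Set.Ioo (0 : ℝ) 1) {n : ℕ} (hn : n ≤ m.N) (g : ℕ → ℝ) :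
    ∑ j ∈ Finset.Icc 1 n, m.P α n j * m.caputo α g j = g n - g 0 := by
  unfold caputo
  simp_rw [Finset.mul_sum]
  rw [Finset.sum_comm' (s' := fun k => Finset.Icc k n) (t' := Finset.Icc 1 n)
    (by intro j k; simp only [Finset.mem_Icc]; omega)]
  have : ∀ k ∈ Finset.Icc 1 n,
      ∑ j ∈ Finset.Icc k n, m.P α n j * (m.A α j k * (g k - g (k - 1))) = g k - g (k - 1) := by
    intro k hk
    rw [Finset.mem_Icc] at hk
    simp_rw [← mul_assoc]
    rw [← Finset.sum_mul, sum_P_mul_A hα hk.1 hk.2 hn, one_mul]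
  rw [Finset.sum_congr rfl this]
  clear this hn
  induction n with
  | zero => simp
  | succ n ih =>
    rw [Finset.sum_Icc_succ_top (by omega), ih]
    simp

/-- Since `A_{j-1}^{(j)} ≥ ω_{1-α}(t_j)`, the complementary kernels integrate `t_j^{-α}`. -/
theorem sum_P_mul_ω_le (hα : α ∈ Set.Ioo (0 : ℝ) 1)
    (hρ : ∀ k, 1 ≤ k → k + 1 ≤ m.N → m.ρ k ≤ 7 / 4) {n : ℕ} (h1 : 1 ≤ n) (hn : n ≤ m.N) :
    ∑ j ∈ Finset.Icc 1 n, m.P α n j * ω (1 - α) (m.t j) ≤ 1 := by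
  refine le_trans (Finset.sum_le_sum fun j hj => ?_) (sum_P_mul_A hα le_rfl h1 hn).le
  rw [Finset.mem_Icc] at hj
  have h := ω_le_A (m := m) hα le_rfl hj.1 (hj.2.trans hn)
  rw [Nat.sub_self, m.t_zero, sub_zero] at h
  exact mul_le_mul_of_nonneg_left h (P_nonneg hα hρ hn j hj.1 hj.2)

end TimeMesh

end Alikhanov

/-! ### Coercivity of the discrete Caputo derivative -/

namespace Alikhanov

/-- Summation by parts against an increasing sequence of coefficients. -/
theorem sum_mul_sub_le {A d : ℕ → ℝ} {n : ℕ} (hn : 1 ≤ n) (hA1 : 0 ≤ A 1)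
    (hA : ∀ k, 1 ≤ k → k < n → A k ≤ A (k + 1)) (hd : ∀ k, 0 ≤ d k) :
    ∑ k ∈ Finset.Icc 1 n, A k * (d k - d (k - 1)) ≤ A n * d n := by
  induction n, hn using Nat.le_induction with
  | base =>
    rw [Finset.Icc_self, Finset.sum_singleton, Nat.sub_self]
    nlinarith [mul_nonneg hA1 (hd 0)]
  | succ n hn ih =>
    rw [Finset.sum_Icc_succ_top (by omega), Nat.add_sub_cancel]
    have h := ih fun k h1 h2 => hA k h1 (by omega)
    nlinarith [mul_le_mul_of_nonneg_right (hA n hn (by omega)) (hd n)]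

namespace TimeMesh

variable {T : ℝ} {m : TimeMesh T} {α : ℝ}

theorem caputo_le_of_nonneg (hα : α ∈ Set.Ioo (0 : ℝ) 1)
    (hρ : ∀ k, 1 ≤ k → k + 1 ≤ m.N → m.ρ k ≤ 7 / 4) {n : ℕ} (h1 : 1 ≤ n) (hn : n ≤ m.N)
    {d : ℕ → ℝ} (hd : ∀ k, 0 ≤ d k) : m.caputo α d n ≤ m.A α n n * d n :=
  sum_mul_sub_le h1 (A_pos hα le_rfl h1 hn).le (fun _ h1 h2 => A_mono hα hρ h1 h2 hn) hd

/-- Freezing a decreasing weight at its last value increases the discrete Caputo derivative. -/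
theorem caputo_weight_le (hα : α ∈ Set.Ioo (0 : ℝ) 1)
    (hρ : ∀ k, 1 ≤ k → k + 1 ≤ m.N → m.ρ k ≤ 7 / 4) {n : ℕ} (h1 : 1 ≤ n) (hn : n ≤ m.N)
    {w g : ℕ → ℝ} (hw : ∀ k ≤ n, w n ≤ w k) (hg : ∀ k, 0 ≤ g k) :
    m.caputo α (fun k => w k * g k) n ≤ w n * m.caputo α g n := by
  have h := caputo_le_of_nonneg hα hρ h1 hn (d := fun k => (w (min k n) - w n) * g k)
    fun k => mul_nonneg (sub_nonneg.2 (hw _ (min_le_right _ _))) (hg k)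
  simp only [min_self, sub_self, zero_mul, mul_zero] at h
  rw [← sub_nonpos]
  refine le_trans (le_of_eq ?_) h
  unfold caputo
  rw [Finset.mul_sum, ← Finset.sum_sub_distrib]
  refine Finset.sum_congr rfl fun k hk => ?_
  rw [Finset.mem_Icc] at hk
  beta_reduce
  rw [min_eq_left hk.2, min_eq_left (by omega : k - 1 ≤ n)]
  ring

/-- Coercivity: with `V = v^{n-θ}`, the difference of the two sides is
`∑_k A_{n-k} ((V - v^{k-1})^2 - (V - v^k)^2) / 2`. Summation by parts leaves only the last two
squares, `(1 - θ)^2` and `θ^2` times `(v^n - v^{n-1})^2`, to be controlled by the gap between the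
two leading coefficients. -/
theorem half_caputo_sq_le (hα : α ∈ Set.Ioo (0 : ℝ) 1)
    (hρ : ∀ k, 1 ≤ k → k + 1 ≤ m.N → m.ρ k ≤ 7 / 4) {n : ℕ} (h1 : 1 ≤ n) (hn : n ≤ m.N)
    (v : ℕ → ℝ) :
    1 / 2 * m.caputo α (fun k => v k ^ 2) n
      ≤ m.caputo α v n * ((1 - α / 2) * v n + α / 2 * v (n - 1)) := by
  obtain ⟨l, rfl⟩ : ∃ l, n = l + 1 := ⟨n - 1, by omega⟩
  set V := (1 - α / 2) * v (l + 1) + α / 2 * v (l + 1 - 1) with hV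
  have e : 2 * (1 / 2 * m.caputo α (fun k => v k ^ 2) (l + 1) - m.caputo α v (l + 1) * V)
      = ∑ k ∈ Finset.Icc 1 (l + 1), m.A α (l + 1) k * ((V - v k) ^ 2 - (V - v (k - 1)) ^ 2) := by
    unfold caputo
    rw [Finset.mul_sum, Finset.sum_mul, ← Finset.sum_sub_distrib, Finset.mul_sum]
    refine Finset.sum_congr rfl fun k _ => ?_
    ring
  suffices h : ∑ k ∈ Finset.Icc 1 (l + 1),
      m.A α (l + 1) k * ((V - v k) ^ 2 - (V - v (k - 1)) ^ 2) ≤ 0 by linarith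
  have hA := A_pos (m := m) hα h1 le_rfl hn
  rw [Finset.sum_Icc_succ_top (by omega)]
  have e1 : V - v (l + 1) = -(α / 2) * (v (l + 1) - v l) := by
    rw [hV, Nat.add_sub_cancel]
    ring
  have e2 : V - v l = (1 - α / 2) * (v (l + 1) - v l) := by
    rw [hV, Nat.add_sub_cancel]
    ring
  rcases Nat.eq_zero_or_pos l with rfl | hl
  · rw [Finset.Icc_eq_empty_of_lt zero_lt_one, Finset.sum_empty, Nat.add_sub_cancel, e1, e2]
    nlinarith [mul_nonneg (mul_nonneg hA.le (sub_nonneg.2 hα.2.le)) (sq_nonneg (v (0 + 1) - v 0))]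
  · have h := sum_mul_sub_le (A := m.A α (l + 1)) hl (A_pos hα le_rfl (by omega) hn).le
      (fun k h1 h2 => A_mono hα hρ h1 (by omega) hn) (d := fun k => (V - v k) ^ 2)
      fun k => sq_nonneg _
    have hgap := mul_A_pred_le hα hρ hl hn
    have hAl := A_pos (m := m) hα hl (Nat.le_succ l) hn
    refine (add_le_add_left h _).trans ?_
    simp only [Nat.add_sub_cancel]
    rw [e1, e2]
    generalize v (l + 1) - v l = x
    have h3 : (1 - α / 2) ^ 2 * m.A α (l + 1) l ≤ (1 - α) * m.A α (l + 1) (l + 1) := by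
      refine le_trans ?_ hgap
      nlinarith [mul_nonneg (mul_nonneg hα.1.le hAl.le) (by linarith [hα.2] : 0 ≤ 1 - α / 2)]
    nlinarith [mul_le_mul_of_nonneg_right h3 (sq_nonneg x)]

/-! ### A discrete Grönwall inequality -/

/-- `e^{μ t}` is a supersolution. The coefficients of the increments over the window
`t_j - 1 / μ ≤ t_{k-1}` are at least `ω_{1-α}(1 / μ)`, and `e^{μ t}` grows by a fixed factor across
that window; if the window reaches `t = 0`, the initial value takes part through `A_{j-1}^{(j)}`. -/
theorem ω_mul_exp_le (hα : α ∈ Set.Ioo (0 : ℝ) 1) {μ : ℝ} (hμ : 0 < μ)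
    (hτ : ∀ k, 1 ≤ k → k ≤ m.N → m.τ k ≤ 1 / (2 * μ)) {j : ℕ} (h1 : 1 ≤ j) (hj : j ≤ m.N) :
    ω (1 - α) (1 / μ) / 3 * Real.exp (μ * m.t j)
      ≤ m.caputo α (fun k => Real.exp (μ * m.t k)) j + m.A α j 1 := by
  set c := ω (1 - α) (1 / μ) with hc
  have hc0 : 0 < c := ω_pos hα (by positivity)
  have hexp : Real.exp (-(1 / 2)) ≤ 2 / 3 := by
    rw [Real.exp_neg, inv_le_comm₀ (Real.exp_pos _) (by norm_num)]
    refine le_trans ?_ (Real.add_one_le_exp _)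
    norm_num
  -- Truncating `e^{μ t}` from below at `E` removes the increments outside the window.
  set E := 2 / 3 * Real.exp (μ * m.t j) with hE
  have hEk : ∀ k, m.t k ≤ m.t j - 1 / (2 * μ) → Real.exp (μ * m.t k) ≤ E := by
    intro k hk
    have : μ * m.t k ≤ -(1 / 2) + μ * m.t j := by
      have := mul_le_mul_of_nonneg_left hk hμ.le
      have e : μ * (m.t j - 1 / (2 * μ)) = -(1 / 2) + μ * m.t j := by
        field_simp
        ring
      linarith
    refine (Real.exp_le_exp.2 this).trans ?_
    rw [Real.exp_add]
    exact mul_le_mul_of_nonneg_right hexp (Real.exp_pos _).le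
  have hstep : ∀ k ∈ Finset.Icc 1 j,
      c * (max (Real.exp (μ * m.t k)) E - max (Real.exp (μ * m.t (k - 1))) E)
        ≤ m.A α j k * (Real.exp (μ * m.t k) - Real.exp (μ * m.t (k - 1))) := by
    intro k hk
    rw [Finset.mem_Icc] at hk
    have hlt : m.t (k - 1) < m.t k := t_strictMono (by omega) (hk.2.trans hj)
    have hmono : Real.exp (μ * m.t (k - 1)) ≤ Real.exp (μ * m.t k) :=
      Real.exp_le_exp.2 (mul_le_mul_of_nonneg_left hlt.le hμ.le)
    have hA := A_pos (m := m) hα hk.1 hk.2 hj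
    rcases le_or_gt (m.t j - 1 / μ) (m.t (k - 1)) with h | h
    · have hcA : c ≤ m.A α j k :=
        (ω_anti hα (sub_pos.2 (t_strictMono (by omega) hj)) (by linarith)).trans
          (ω_le_A hα hk.1 hk.2 hj)
      refine mul_le_mul hcA ?_ (sub_nonneg.2 (max_le_max_right _ hmono)) hA.le
      rcases le_total (Real.exp (μ * m.t (k - 1))) E with h' | h'
      · rw [max_eq_right h']
        rcases le_total (Real.exp (μ * m.t k)) E with h'' | h''
        · rw [max_eq_right h'']
          linarith
        · rw [max_eq_left h'']
          linarith
      · rw [max_eq_left h', max_eq_left (h'.trans hmono)]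
    · have h2 := hτ k hk.1 (hk.2.trans hj)
      unfold τ at h2
      have e : 1 / μ = 1 / (2 * μ) + 1 / (2 * μ) := by
        field_simp
        ring
      rw [max_eq_right (hEk k (by linarith)),
        max_eq_right (hmono.trans (hEk k (by linarith))), sub_self, mul_zero]
      exact mul_nonneg hA.le (sub_nonneg.2 hmono)
  have hsum := Finset.sum_le_sum hstep
  rw [← Finset.mul_sum] at hsum
  have htel : ∀ n, ∑ k ∈ Finset.Icc 1 n,
      (max (Real.exp (μ * m.t k)) E - max (Real.exp (μ * m.t (k - 1))) E)
      = max (Real.exp (μ * m.t n)) E - max (Real.exp (μ * m.t 0)) E := by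
    intro n
    induction n with
    | zero => simp
    | succ n ih =>
      rw [Finset.sum_Icc_succ_top (by omega), ih, Nat.add_sub_cancel]
      ring
  have hEj : E ≤ Real.exp (μ * m.t j) := by
    have := Real.exp_pos (μ * m.t j)
    linarith
  rw [htel, max_eq_left hEj, m.t_zero, mul_zero, Real.exp_zero] at hsum
  change _ ≤ m.caputo α (fun k => Real.exp (μ * m.t k)) j at hsum
  have hA1 := A_pos (m := m) hα le_rfl h1 hj
  rcases le_total 1 E with h | h
  · rw [max_eq_right h] at hsum
    have : c / 3 * Real.exp (μ * m.t j) = c * (Real.exp (μ * m.t j) - E) := by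
      rw [hE]
      ring
    linarith
  · rw [max_eq_left h] at hsum
    -- Here `e^{μ t_j} ≤ 3 / 2`, so that the whole interval `[0, t_j]` lies in the window.
    have htj : m.t j ≤ 1 / μ := by
      rw [le_div_iff₀ hμ]
      have := Real.add_one_le_exp (μ * m.t j)
      linarith
    have hcA : c ≤ m.A α j 1 := by
      have h0 := ω_le_A (m := m) hα le_rfl h1 hj
      rw [Nat.sub_self, m.t_zero, sub_zero] at h0
      exact (ω_anti hα (t_pos h1 hj) htj).trans h0
    nlinarith [Real.exp_pos (μ * m.t j)]

theorem sum_P_mul_exp_le (hα : α ∈ Set.Ioo (0 : ℝ) 1)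
    (hρ : ∀ k, 1 ≤ k → k + 1 ≤ m.N → m.ρ k ≤ 7 / 4) {μ : ℝ} (hμ : 0 < μ)
    (hτ : ∀ k, 1 ≤ k → k ≤ m.N → m.τ k ≤ 1 / (2 * μ)) {n : ℕ} (h1 : 1 ≤ n) (hn : n ≤ m.N) :
    ω (1 - α) (1 / μ) * ∑ j ∈ Finset.Icc 1 n, m.P α n j * Real.exp (μ * m.t j)
      ≤ 3 * Real.exp (μ * m.t n) := by
  have h : ∑ j ∈ Finset.Icc 1 n, m.P α n j * (ω (1 - α) (1 / μ) / 3 * Real.exp (μ * m.t j))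
      ≤ ∑ j ∈ Finset.Icc 1 n,
          m.P α n j * (m.caputo α (fun k => Real.exp (μ * m.t k)) j + m.A α j 1) := by
    refine Finset.sum_le_sum fun j hj => ?_
    rw [Finset.mem_Icc] at hj
    exact mul_le_mul_of_nonneg_left (ω_mul_exp_le hα hμ hτ hj.1 (hj.2.trans hn))
      (P_nonneg hα hρ hn j hj.1 hj.2)
  simp_rw [mul_add] at h
  rw [Finset.sum_add_distrib, sum_P_mul_caputo hα hn, sum_P_mul_A hα le_rfl h1 hn,
    m.t_zero, mul_zero, Real.exp_zero, sub_add_cancel] at h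
  have e : ∑ j ∈ Finset.Icc 1 n, m.P α n j * (ω (1 - α) (1 / μ) / 3 * Real.exp (μ * m.t j))
      = ω (1 - α) (1 / μ) * (∑ j ∈ Finset.Icc 1 n, m.P α n j * Real.exp (μ * m.t j)) / 3 := by
    rw [Finset.mul_sum, Finset.sum_div]
    refine Finset.sum_congr rfl fun j _ => ?_
    ring
  rw [e] at h
  linarith

/-- Discrete fractional Grönwall inequality for an energy inequality. The quotient
`y_k / e^{μ t_k / 2}` is estimated at the index where it is largest: there the term with `Λ` is
at most half of the left-hand side. -/
theorem le_of_caputo_sq_le (hα : α ∈ Set.Ioo (0 : ℝ) 1)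
    (hρ : ∀ k, 1 ≤ k → k + 1 ≤ m.N → m.ρ k ≤ 7 / 4) {μ Λ : ℝ} (hμ : 0 < μ) (hΛ : 0 ≤ Λ)
    (hΛμ : 6 * Λ ≤ ω (1 - α) (1 / μ))
    (hτ : ∀ k, 1 ≤ k → k ≤ m.N → m.τ k ≤ 1 / (2 * μ)) {n : ℕ} (hn : n ≤ m.N)
    {y F : ℕ → ℝ} (hy : ∀ k, 0 ≤ y k) (hF : ∀ k, 0 ≤ F k) {M : ℝ} (hM : 0 ≤ M)
    (henergy : ∀ j, 1 ≤ j → j ≤ n → m.caputo α (fun k => y k ^ 2) j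
      ≤ Λ * max (y j) (y (j - 1)) ^ 2 + max (y j) (y (j - 1)) * F j)
    (hFM : ∀ k, 1 ≤ k → k ≤ n → ∑ j ∈ Finset.Icc 1 k, m.P α k j * F j ≤ M) :
    y n ≤ 2 * Real.exp (μ * m.t n / 2) * (y 0 + M) := by
  obtain ⟨k, hk, hmax⟩ := Finset.exists_max_image (Finset.range (n + 1))
    (fun k => y k / Real.exp (μ * m.t k / 2)) ⟨0, by simp⟩
  simp only [Finset.mem_range, Nat.lt_succ_iff] at hk hmax
  set S := y k / Real.exp (μ * m.t k / 2) with hS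
  have hS0 : 0 ≤ S := div_nonneg (hy k) (Real.exp_pos _).le
  have hyS : ∀ l ≤ n, y l ≤ S * Real.exp (μ * m.t l / 2) := fun l hl =>
    (div_le_iff₀ (Real.exp_pos _)).1 (hmax l hl)
  suffices hfin : S ≤ 2 * (y 0 + M) by
    refine (hyS n le_rfl).trans ?_
    nlinarith [Real.exp_pos (μ * m.t n / 2)]
  have hy0 : y 0 ≤ S := by
    have := hyS 0 (Nat.zero_le n)
    rwa [m.t_zero, mul_zero, zero_div, Real.exp_zero, mul_one] at this
  rcases Nat.eq_zero_or_pos k with rfl | hk1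
  · rw [hS, m.t_zero, mul_zero, zero_div, Real.exp_zero, div_one]
    linarith [hy 0]
  have hkN := hk.trans hn
  have hexp1 : 1 ≤ Real.exp (μ * m.t k / 2) := by
    have := mul_nonneg hμ.le (t_nonneg (m := m) hkN)
    exact Real.one_le_exp (by linarith)
  have hyk : y k = S * Real.exp (μ * m.t k / 2) := by
    rw [hS]
    field_simp
  have hsq : ∀ l, Real.exp (μ * m.t l / 2) ^ 2 = Real.exp (μ * m.t l) := by
    intro l
    rw [← Real.exp_nat_mul]
    congr 1
    push_cast
    ring
  have hmaxy : ∀ j, 1 ≤ j → j ≤ k →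
      max (y j) (y (j - 1)) ≤ S * Real.exp (μ * m.t j / 2) := by
    intro j h1 hjk
    refine max_le (hyS j (hjk.trans hk)) ((hyS (j - 1) (by omega)).trans ?_)
    have := mul_le_mul_of_nonneg_left
      (t_mono (m := m) (show j - 1 ≤ j by omega) (hjk.trans hkN)) hμ.le
    exact mul_le_mul_of_nonneg_left (Real.exp_le_exp.2 (by linarith)) hS0
  have hsum : ∑ j ∈ Finset.Icc 1 k, m.P α k j * m.caputo α (fun k => y k ^ 2) j
      ≤ ∑ j ∈ Finset.Icc 1 k, (Λ * S ^ 2 * (m.P α k j * Real.exp (μ * m.t j))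
          + S * Real.exp (μ * m.t k / 2) * (m.P α k j * F j)) := by
    refine Finset.sum_le_sum fun j hj => ?_
    obtain ⟨h1, hjk⟩ := Finset.mem_Icc.1 hj
    have hP := P_nonneg hα hρ hkN j h1 hjk
    have h2 := hmaxy j h1 hjk
    have h3 : 0 ≤ max (y j) (y (j - 1)) := (hy j).trans (le_max_left _ _)
    have h4 : max (y j) (y (j - 1)) ^ 2 ≤ S ^ 2 * Real.exp (μ * m.t j) := by
      rw [← hsq, ← mul_pow]
      exact pow_le_pow_left₀ h3 h2 2
    have h5 : max (y j) (y (j - 1)) ≤ S * Real.exp (μ * m.t k / 2) := by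
      have := mul_le_mul_of_nonneg_left (t_mono (m := m) hjk hkN) hμ.le
      exact h2.trans (mul_le_mul_of_nonneg_left (Real.exp_le_exp.2 (by linarith)) hS0)
    have h6 := (henergy j h1 (hjk.trans hk)).trans
      (add_le_add (mul_le_mul_of_nonneg_left h4 hΛ) (mul_le_mul_of_nonneg_right h5 (hF j)))
    refine (mul_le_mul_of_nonneg_left h6 hP).trans (le_of_eq ?_)
    ring
  rw [sum_P_mul_caputo hα hkN, Finset.sum_add_distrib, ← Finset.mul_sum, ← Finset.mul_sum] at hsum
  have hPexp := sum_P_mul_exp_le hα hρ hμ hτ hk1 hkN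
  have hPF := hFM k hk1 hk
  have hPexp0 : 0 ≤ ∑ j ∈ Finset.Icc 1 k, m.P α k j * Real.exp (μ * m.t j) :=
    Finset.sum_nonneg fun j hj => by
      obtain ⟨h1, hjk⟩ := Finset.mem_Icc.1 hj
      exact mul_nonneg (P_nonneg hα hρ hkN j h1 hjk) (Real.exp_pos _).le
  rw [← hsq] at hPexp
  have hΛP : Λ * ∑ j ∈ Finset.Icc 1 k, m.P α k j * Real.exp (μ * m.t j)
      ≤ Real.exp (μ * m.t k / 2) ^ 2 / 2 := by
    have := mul_le_mul_of_nonneg_right hΛμ hPexp0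
    linarith
  rw [hyk] at hsum
  generalize Real.exp (μ * m.t k / 2) = e at *
  generalize ∑ j ∈ Finset.Icc 1 k, m.P α k j * F j = PF at *
  have h1 := mul_le_mul_of_nonneg_left hΛP (sq_nonneg S)
  have hSe : 0 ≤ S * e := by positivity
  have hSle : S ≤ S * e := le_mul_of_one_le_right hS0 hexp1
  have h2 := mul_le_mul_of_nonneg_left hPF hSe
  have h3 : y 0 ^ 2 ≤ S * e * y 0 := by
    nlinarith [hy 0, hy0.trans hSle]
  have h4 : S * e * (S * e) ≤ S * e * (2 * (y 0 + M)) := by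
    nlinarith
  rcases hSe.eq_or_lt with h0 | hpos
  · linarith [hy 0]
  · exact hSle.trans (le_of_mul_le_mul_left h4 hpos)

end TimeMesh

theorem exists_le_ω (hα : α ∈ Set.Ioo (0 : ℝ) 1) {L : ℝ} (hL : 0 < L) :
    ∃ μ : ℝ, 0 < μ ∧ L ≤ ω (1 - α) (1 / μ) := by
  have hΓ := gamma_one_sub_pos hα
  have hp : 0 < L * Real.Gamma (1 - α) := mul_pos hL hΓ
  refine ⟨(L * Real.Gamma (1 - α)) ^ (1 / α), Real.rpow_pos_of_pos hp _, le_of_eq ?_⟩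
  rw [ω_one_sub, one_div ((L * Real.Gamma (1 - α)) ^ (1 / α)), Real.inv_rpow (by positivity),
    ← Real.rpow_neg (by positivity), ← Real.rpow_mul hp.le,
    show 1 / α * -(-α) = 1 by field_simp [hα.1.ne'], Real.rpow_one]
  field_simp

end Alikhanov

/-! ### Edges of the space grid and summation by parts -/

namespace Alikhanov

theorem sum_mul_sub_eq_neg {M : ℕ} (hM : 0 < M) {g : ℕ → ℝ} (h0 : g 0 = 0) (hgM : g M = 0)
    (q : ℕ → ℝ) :
    ∑ i ∈ Finset.Ico 1 M, g i * (q i - q (i - 1))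
      = -∑ i ∈ Finset.range M, q i * (g (i + 1) - g i) := by
  have key : ∀ n, ∑ i ∈ Finset.Ico 1 (n + 1), g i * (q i - q (i - 1))
      + ∑ i ∈ Finset.range (n + 1), q i * (g (i + 1) - g i) = g (n + 1) * q n - g 0 * q 0 := by
    intro n
    induction n with
    | zero =>
      simp
      ring
    | succ n ih =>
      rw [Finset.sum_Ico_succ_top (by omega), Finset.sum_range_succ, Nat.add_sub_cancel]
      linarith
  obtain ⟨n, rfl⟩ : ∃ n, M = n + 1 := ⟨M - 1, by omega⟩
  have := key n
  rw [h0, hgM] at this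
  linarith

theorem sum_sq_mean_le (M : ℕ) (q : ℕ → ℝ) :
    ∑ i ∈ Finset.Ico 1 M, ((q i + q (i - 1)) / 2) ^ 2 ≤ ∑ i ∈ Finset.range M, q i ^ 2 := by
  have key : ∀ n, ∑ i ∈ Finset.Ico 1 (n + 1), ((q i + q (i - 1)) / 2) ^ 2
      ≤ ∑ i ∈ Finset.range (n + 1), q i ^ 2 - q n ^ 2 / 2 := by
    intro n
    induction n with
    | zero =>
      simp
      linarith [sq_nonneg (q 0)]
    | succ n ih =>
      rw [Finset.sum_Ico_succ_top (by omega), Finset.sum_range_succ _ (n + 1), Nat.add_sub_cancel]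
      nlinarith [sq_nonneg (q (n + 1) - q n)]
  rcases Nat.eq_zero_or_pos M with rfl | hM
  · simp
  · obtain ⟨n, rfl⟩ : ∃ n, M = n + 1 := ⟨M - 1, by omega⟩
    linarith [key n, sq_nonneg (q n)]

theorem sum_sq_le_of_zero {M : ℕ} {v : ℕ → ℝ} (h0 : v 0 = 0) :
    ∑ i ∈ Finset.Ico 1 M, v i ^ 2
      ≤ (M : ℝ) ^ 2 * ∑ i ∈ Finset.range M, (v (i + 1) - v i) ^ 2 := by
  have hS : 0 ≤ ∑ i ∈ Finset.range M, (v (i + 1) - v i) ^ 2 :=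
    Finset.sum_nonneg fun _ _ => sq_nonneg _
  have h : ∀ i ∈ Finset.Ico 1 M,
      v i ^ 2 ≤ M * ∑ i ∈ Finset.range M, (v (i + 1) - v i) ^ 2 := by
    intro i hi
    rw [Finset.mem_Ico] at hi
    have e : v i = ∑ l ∈ Finset.range i, (v (l + 1) - v l) := by
      rw [Finset.sum_range_sub, h0, sub_zero]
    rw [e]
    refine sq_sum_le_card_mul_sum_sq.trans ?_
    rw [Finset.card_range]
    refine mul_le_mul (by exact_mod_cast hi.2.le) ?_
      (Finset.sum_nonneg fun _ _ => sq_nonneg _) (Nat.cast_nonneg _)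
    exact Finset.sum_le_sum_of_subset_of_nonneg (Finset.range_mono hi.2.le)
      fun _ _ _ => sq_nonneg _
  refine (Finset.sum_le_sum h).trans ?_
  rw [Finset.sum_const, Nat.card_Ico, nsmul_eq_mul, pow_two, mul_assoc]
  refine mul_le_mul_of_nonneg_right ?_ (by positivity)
  exact_mod_cast Nat.sub_le M 1

namespace SpaceGrid

variable {R : Rectangle} (G : SpaceGrid R)

theorem hx_pos : 0 < G.hx :=
  div_pos (sub_pos.2 R.x_lt) (by exact_mod_cast G.Mx_pos)

theorem hy_pos : 0 < G.hy :=
  div_pos (sub_pos.2 R.y_lt) (by exact_mod_cast G.My_pos)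

theorem Mx_mul_hx : G.Mx * G.hx = R.xr - R.xl := by
  have : (G.Mx : ℝ) ≠ 0 := by exact_mod_cast G.Mx_pos.ne'
  unfold hx
  field_simp

theorem My_mul_hy : G.My * G.hy = R.yr - R.yl := by
  have : (G.My : ℝ) ≠ 0 := by exact_mod_cast G.My_pos.ne'
  unfold hy
  field_simp

theorem x_mem {r : ℝ} (h0 : 0 < r) (h1 : r < G.Mx) : G.x r ∈ Set.Ioo R.xl R.xr := by
  have := G.hx_pos
  have e := G.Mx_mul_hx
  unfold x
  constructor <;> nlinarith

theorem y_mem {r : ℝ} (h0 : 0 < r) (h1 : r < G.My) : G.y r ∈ Set.Ioo R.yl R.yr := by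
  have := G.hy_pos
  have e := G.My_mul_hy
  unfold y
  constructor <;> nlinarith

/-- The indices of the interior grid points. -/
def interior : Finset (ℕ × ℕ) := Finset.Ico 1 G.Mx ×ˢ Finset.Ico 1 G.My

/-- The edges of the grid that do not lie on the boundary of the rectangle: `Sum.inl (i, j)` is the horizontal edge with
midpoint `(i + 1/2, j)`, and `Sum.inr (i, j)` is the vertical edge with midpoint `(i, j + 1/2)`. -/
def edges : Finset ((ℕ × ℕ) ⊕ (ℕ × ℕ)) :=
  (Finset.range G.Mx ×ˢ Finset.Ico 1 G.My).disjSum (Finset.Ico 1 G.Mx ×ˢ Finset.range G.My)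

/-- The discrete gradient of a grid function, as a function on the edges. -/
noncomputable def grad (u : ℕ → ℕ → ℝ) : (ℕ × ℕ) ⊕ (ℕ × ℕ) → ℝ
  | .inl e => G.δx u e.1 e.2
  | .inr e => G.δy u e.1 e.2

theorem mem_interior {q : ℕ × ℕ} : q ∈ G.interior ↔ G.Interior q.1 q.2 := by
  simp only [interior, Finset.mem_product, Finset.mem_Ico, Interior]
  omega

theorem mem_of_interior {i j : ℕ} (h : G.Interior i j) : R.Mem (G.x i) (G.y j) := by
  obtain ⟨⟨h1, h2⟩, h3, h4⟩ := h
  exact ⟨G.x_mem (by exact_mod_cast h1) (by exact_mod_cast h2),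
    G.y_mem (by exact_mod_cast h3) (by exact_mod_cast h4)⟩

theorem sum_edges (F : (ℕ × ℕ) ⊕ (ℕ × ℕ) → ℝ) :
    ∑ e ∈ G.edges, F e
      = ∑ i ∈ Finset.range G.Mx, ∑ j ∈ Finset.Ico 1 G.My, F (.inl (i, j))
        + ∑ i ∈ Finset.Ico 1 G.Mx, ∑ j ∈ Finset.range G.My, F (.inr (i, j)) := by
  rw [edges, Finset.sum_disjSum, Finset.sum_product, Finset.sum_product]

theorem area_nonneg : 0 ≤ G.hx * G.hy := (mul_pos G.hx_pos G.hy_pos).le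

theorem normGrad_nonneg (u : ℕ → ℕ → ℝ) : 0 ≤ G.normGrad u := Real.sqrt_nonneg _

theorem normGrad_sq (u : ℕ → ℕ → ℝ) :
    G.normGrad u ^ 2 = G.hx * G.hy * ∑ e ∈ G.edges, G.grad u e ^ 2 := by
  have h := G.area_nonneg
  unfold normGrad normδx normδy
  rw [Real.sq_sqrt (by positivity),
    Real.sq_sqrt (mul_nonneg h (Finset.sum_nonneg fun _ _ => Finset.sum_nonneg fun _ _ =>
      sq_nonneg _)),
    Real.sq_sqrt (mul_nonneg h (Finset.sum_nonneg fun _ _ => Finset.sum_nonneg fun _ _ =>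
      sq_nonneg _)), sum_edges, mul_add]
  rfl

theorem sum_δx_sq_le_normGrad_sq (u : ℕ → ℕ → ℝ) :
    G.hx * G.hy * ∑ j ∈ Finset.Ico 1 G.My, ∑ i ∈ Finset.range G.Mx, G.δx u i j ^ 2
      ≤ G.normGrad u ^ 2 := by
  rw [normGrad_sq, sum_edges, Finset.sum_comm]
  refine mul_le_mul_of_nonneg_left (le_add_of_nonneg_right ?_) G.area_nonneg
  exact Finset.sum_nonneg fun _ _ => Finset.sum_nonneg fun _ _ => sq_nonneg _

theorem sum_δy_sq_le_normGrad_sq (u : ℕ → ℕ → ℝ) :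
    G.hx * G.hy * ∑ i ∈ Finset.Ico 1 G.Mx, ∑ j ∈ Finset.range G.My, G.δy u i j ^ 2
      ≤ G.normGrad u ^ 2 := by
  rw [normGrad_sq, sum_edges]
  refine mul_le_mul_of_nonneg_left (le_add_of_nonneg_left ?_) G.area_nonneg
  exact Finset.sum_nonneg fun _ _ => Finset.sum_nonneg fun _ _ => sq_nonneg _

theorem sum_δxhat_sq_le (u : ℕ → ℕ → ℝ) :
    G.hx * G.hy * ∑ q ∈ G.interior, G.δxhat u q.1 q.2 ^ 2 ≤ G.normGrad u ^ 2 := by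
  refine le_trans ?_ (G.sum_δx_sq_le_normGrad_sq u)
  refine mul_le_mul_of_nonneg_left ?_ G.area_nonneg
  rw [interior, Finset.sum_product_right]
  refine Finset.sum_le_sum fun j _ => le_trans (le_of_eq ?_)
    (sum_sq_mean_le G.Mx fun i => G.δx u i j)
  refine Finset.sum_congr rfl fun i hi => ?_
  have := G.hx_pos.ne'
  have e : i - 1 + 1 = i := Nat.sub_add_cancel (Finset.mem_Ico.1 hi).1
  simp only [δxhat, δx, e]
  field_simp
  ring

theorem sum_δyhat_sq_le (u : ℕ → ℕ → ℝ) :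
    G.hx * G.hy * ∑ q ∈ G.interior, G.δyhat u q.1 q.2 ^ 2 ≤ G.normGrad u ^ 2 := by
  refine le_trans ?_ (G.sum_δy_sq_le_normGrad_sq u)
  refine mul_le_mul_of_nonneg_left ?_ G.area_nonneg
  rw [interior, Finset.sum_product]
  refine Finset.sum_le_sum fun i _ => le_trans (le_of_eq ?_)
    (sum_sq_mean_le G.My fun j => G.δy u i j)
  refine Finset.sum_congr rfl fun j hj => ?_
  have := G.hy_pos.ne'
  have e : j - 1 + 1 = j := Nat.sub_add_cancel (Finset.mem_Ico.1 hj).1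
  simp only [δyhat, δy, e]
  field_simp
  ring

variable {G}

theorem VanishesOnBoundary.left {u : ℕ → ℕ → ℝ} (hu : G.VanishesOnBoundary u) {j : ℕ}
    (hj : j ≤ G.My) : u 0 j = 0 :=
  hu 0 j (Nat.zero_le _) hj fun h => absurd h.1.1 (by omega)

theorem VanishesOnBoundary.right {u : ℕ → ℕ → ℝ} (hu : G.VanishesOnBoundary u) {j : ℕ}
    (hj : j ≤ G.My) : u G.Mx j = 0 :=
  hu G.Mx j le_rfl hj fun h => absurd h.1.2 (by omega)

theorem VanishesOnBoundary.bottom {u : ℕ → ℕ → ℝ} (hu : G.VanishesOnBoundary u) {i : ℕ}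
    (hi : i ≤ G.Mx) : u i 0 = 0 :=
  hu i 0 hi (Nat.zero_le _) fun h => absurd h.2.1 (by omega)

theorem VanishesOnBoundary.top {u : ℕ → ℕ → ℝ} (hu : G.VanishesOnBoundary u) {i : ℕ}
    (hi : i ≤ G.Mx) : u i G.My = 0 :=
  hu i G.My hi le_rfl fun h => absurd h.2.2 (by omega)

theorem vanishesOnBoundary_restrict (g : ℝ → ℝ → ℝ) : G.VanishesOnBoundary (G.restrict g) :=
  fun _ _ _ _ h => if_neg h

theorem mem_of_inl_mem_edges {e : ℕ × ℕ} (he : Sum.inl e ∈ G.edges) :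
    R.Mem (G.x (e.1 + 1 / 2)) (G.y e.2) := by
  simp only [edges, Finset.inl_mem_disjSum, Finset.mem_product, Finset.mem_range,
    Finset.mem_Ico] at he
  have h1 : (e.1 : ℝ) + 1 ≤ G.Mx := by exact_mod_cast he.1
  exact ⟨G.x_mem (by positivity) (by linarith),
    G.y_mem (by exact_mod_cast he.2.1) (by exact_mod_cast he.2.2)⟩

theorem mem_of_inr_mem_edges {e : ℕ × ℕ} (he : Sum.inr e ∈ G.edges) :
    R.Mem (G.x e.1) (G.y (e.2 + 1 / 2)) := by
  simp only [edges, Finset.inr_mem_disjSum, Finset.mem_product, Finset.mem_range,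
    Finset.mem_Ico] at he
  have h1 : (e.2 : ℝ) + 1 ≤ G.My := by exact_mod_cast he.2
  exact ⟨G.x_mem (by exact_mod_cast he.1.1) (by exact_mod_cast he.1.2),
    G.y_mem (by positivity) (by linarith)⟩

/-- The discrete Poincaré inequality. -/
theorem VanishesOnBoundary.sum_sq_le {u : ℕ → ℕ → ℝ} (hu : G.VanishesOnBoundary u) :
    G.hx * G.hy * ∑ q ∈ G.interior, u q.1 q.2 ^ 2 ≤ (R.xr - R.xl) ^ 2 * G.normGrad u ^ 2 := by
  refine le_trans ?_ (mul_le_mul_of_nonneg_left (G.sum_δx_sq_le_normGrad_sq u) (sq_nonneg _))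
  rw [mul_left_comm]
  refine mul_le_mul_of_nonneg_left ?_ G.area_nonneg
  rw [interior, Finset.sum_product_right, Finset.mul_sum]
  refine Finset.sum_le_sum fun j hj => ?_
  refine (sum_sq_le_of_zero (v := fun i => u i j) (hu.left (Finset.mem_Ico.1 hj).2.le)).trans (le_of_eq ?_)
  rw [← G.Mx_mul_hx, mul_pow, mul_assoc, Finset.mul_sum (a := G.hx ^ 2)]
  congr 1
  refine Finset.sum_congr rfl fun i _ => ?_
  have := G.hx_pos.ne'
  unfold δx
  field_simp

end SpaceGrid

namespace Coefficients

variable {R : Rectangle} (c : Coefficients) (G : SpaceGrid R)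

/-- The diffusion coefficient at the midpoint of an edge: `p₁` on horizontal edges and `p₂` on
vertical edges. -/
noncomputable def edgeWeight (t : ℝ) : (ℕ × ℕ) ⊕ (ℕ × ℕ) → ℝ
  | .inl e => c.p₁ (G.x (e.1 + 1 / 2)) (G.y e.2) t
  | .inr e => c.p₂ (G.x e.1) (G.y (e.2 + 1 / 2)) t

/-- The symmetric part `δ_x [p₁ δ_x v] + δ_y [p₂ δ_y v]` of the discrete elliptic operator,
without the factor `p⁻¹`. -/
noncomputable def divGrad (t : ℝ) (v : ℕ → ℕ → ℝ) (i j : ℕ) : ℝ :=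
  (c.p₁ (G.x (i + 1 / 2)) (G.y j) t * G.δx v i j
      - c.p₁ (G.x (i - 1 / 2)) (G.y j) t * G.δx v (i - 1) j) / G.hx
    + (c.p₂ (G.x i) (G.y (j + 1 / 2)) t * G.δy v i j
      - c.p₂ (G.x i) (G.y (j - 1 / 2)) t * G.δy v i (j - 1)) / G.hy

variable {G}

/-- Summation by parts on the grid. -/
theorem sum_mul_divGrad (t : ℝ) (v : ℕ → ℕ → ℝ) {g : ℕ → ℕ → ℝ}
    (hg : G.VanishesOnBoundary g) :
    ∑ q ∈ G.interior, g q.1 q.2 * c.divGrad G t v q.1 q.2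
      = -∑ e ∈ G.edges, c.edgeWeight G t e * (G.grad v e * G.grad g e) := by
  have hX := G.hx_pos.ne'
  have hY := G.hy_pos.ne'
  rw [SpaceGrid.sum_edges, neg_add]
  simp only [divGrad, mul_add]
  rw [Finset.sum_add_distrib]
  congr 1
  · rw [SpaceGrid.interior, Finset.sum_product_right,
      Finset.sum_comm (s := Finset.range G.Mx), ← Finset.sum_neg_distrib]
    refine Finset.sum_congr rfl fun j hj => ?_
    have hjM := (Finset.mem_Ico.1 hj).2.le
    have h := sum_mul_sub_eq_neg G.Mx_pos (g := fun i => g i j) (hg.left hjM) (hg.right hjM)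
      fun i => c.p₁ (G.x (i + 1 / 2)) (G.y j) t * G.δx v i j / G.hx
    refine Eq.trans (Finset.sum_congr rfl fun i hi => ?_) (h.trans ?_)
    · have e : (((i - 1 : ℕ) : ℝ) + 1 / 2) = i - 1 / 2 := by
        rw [Nat.cast_sub (Finset.mem_Ico.1 hi).1]
        push_cast
        ring
      rw [e, sub_div]
    · congr 1
      refine Finset.sum_congr rfl fun i _ => ?_
      simp only [edgeWeight, SpaceGrid.grad, SpaceGrid.δx]
      field_simp
  · rw [SpaceGrid.interior, Finset.sum_product, ← Finset.sum_neg_distrib]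
    refine Finset.sum_congr rfl fun i hi => ?_
    have hiM := (Finset.mem_Ico.1 hi).2.le
    have h := sum_mul_sub_eq_neg G.My_pos (hg.bottom hiM) (hg.top hiM)
      fun j => c.p₂ (G.x i) (G.y (j + 1 / 2)) t * G.δy v i j / G.hy
    refine Eq.trans (Finset.sum_congr rfl fun j hj => ?_) (h.trans ?_)
    · have e : (((j - 1 : ℕ) : ℝ) + 1 / 2) = j - 1 / 2 := by
        rw [Nat.cast_sub (Finset.mem_Ico.1 hj).1]
        push_cast
        ring
      rw [e, sub_div]
    · congr 1
      refine Finset.sum_congr rfl fun j _ => ?_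
      simp only [edgeWeight, SpaceGrid.grad, SpaceGrid.δy]
      field_simp

/-! ### The diffusion coefficients -/

theorem monotoneOn_mul_exp {a : ℝ → ℝ} {C T : ℝ} (ha : ContDiffOn ℝ 1 a (Set.Icc 0 T))
    (hpos : ∀ t ∈ Set.Icc 0 T, 0 < a t)
    (hlog : ∀ t ∈ Set.Icc 0 T, |derivWithin a (Set.Icc 0 T) t / a t| ≤ C) :
    MonotoneOn (fun t => a t * Real.exp (C * t)) (Set.Icc 0 T) := by
  have hE : ∀ t, HasDerivAt (fun t => Real.exp (C * t)) (Real.exp (C * t) * C) t := fun t => by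
    simpa using ((hasDerivAt_id t).const_mul C).exp
  have hd : ∀ t ∈ interior (Set.Icc 0 T), HasDerivAt (fun t => a t * Real.exp (C * t))
      (derivWithin a (Set.Icc 0 T) t * Real.exp (C * t)
        + a t * (Real.exp (C * t) * C)) t := by
    intro t ht
    have hnhds : Set.Icc 0 T ∈ nhds t := mem_interior_iff_mem_nhds.1 ht
    have h := ((ha.differentiableOn one_ne_zero) t (interior_subset ht)).hasDerivWithinAt.hasDerivAt
      hnhds
    exact h.mul (hE t)
  refine monotoneOn_of_deriv_nonneg (convex_Icc 0 T)
    (ha.continuousOn.mul (by fun_prop))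
    (fun t ht => (hd t ht).differentiableAt.differentiableWithinAt) fun t ht => ?_
  rw [(hd t ht).deriv]
  have hm := interior_subset ht
  have h := (abs_le.1 (hlog t hm)).1
  rw [le_div_iff₀ (hpos t hm)] at h
  have := mul_nonneg (by linarith : 0 ≤ derivWithin a (Set.Icc 0 T) t + C * a t)
    (Real.exp_pos (C * t)).le
  linarith

theorem antitoneOn_div {a : ℝ → ℝ} {C T d : ℝ} (hd : 0 < d) (ha : ContDiffOn ℝ 1 a (Set.Icc 0 T))
    (hpos : ∀ t ∈ Set.Icc 0 T, 0 < a t)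
    (hlog : ∀ t ∈ Set.Icc 0 T, |derivWithin a (Set.Icc 0 T) t / a t| ≤ C) :
    AntitoneOn (fun t => d * Real.exp (-C * t) / a t) (Set.Icc 0 T) := by
  intro s hs t ht hst
  have h := monotoneOn_mul_exp ha hpos hlog hs ht hst
  have e : ∀ r ∈ Set.Icc 0 T, d * Real.exp (-C * r) / a r = d / (a r * Real.exp (C * r)) := by
    intro r hr
    have h1 := (hpos r hr).ne'
    have h2 := (Real.exp_pos (C * r)).ne'
    rw [neg_mul, Real.exp_neg]
    field_simp
  simp only
  rw [e s hs, e t ht]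
  exact div_le_div_of_nonneg_left hd.le (mul_pos (hpos s hs) (Real.exp_pos _)) h

variable {c} {T : ℝ}

theorem p_pos (hV : c.V1 R T) (hA : c.Admissible R T) {x y t : ℝ} (h : R.Mem x y)
    (ht : t ∈ Set.Icc 0 T) : 0 < c.p x y t :=
  div_pos (mul_pos (hA.d_pos x y h) (Real.exp_pos _))
    (mul_pos (hV.a₁_pos x y h t ht) (hV.a₂_pos x y h t ht))

theorem p₁_pos (hV : c.V1 R T) (hA : c.Admissible R T) {x y t : ℝ} (h : R.Mem x y)
    (ht : t ∈ Set.Icc 0 T) : 0 < c.p₁ x y t :=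
  div_pos (mul_pos (hA.d_pos x y h) (Real.exp_pos _)) (hV.a₂_pos x y h t ht)

theorem p₂_pos (hV : c.V1 R T) (hA : c.Admissible R T) {x y t : ℝ} (h : R.Mem x y)
    (ht : t ∈ Set.Icc 0 T) : 0 < c.p₂ x y t :=
  div_pos (mul_pos (hA.d_pos x y h) (Real.exp_pos _)) (hV.a₁_pos x y h t ht)

/-- The role of the factor `e^{-C_p t}` and of the bound on the logarithmic derivatives. -/
theorem p₁_antitoneOn (hV : c.V1 R T) (hA : c.Admissible R T) {x y : ℝ} (h : R.Mem x y) :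
    AntitoneOn (c.p₁ x y) (Set.Icc 0 T) :=
  antitoneOn_div (hA.d_pos x y h) (hV.a₂_C1 x y h) (hV.a₂_pos x y h) fun t ht =>
    (le_add_of_nonneg_left (abs_nonneg _)).trans (hV.log_deriv_le x y h t ht)

theorem p₂_antitoneOn (hV : c.V1 R T) (hA : c.Admissible R T) {x y : ℝ} (h : R.Mem x y) :
    AntitoneOn (c.p₂ x y) (Set.Icc 0 T) :=
  antitoneOn_div (hA.d_pos x y h) (hV.a₁_C1 x y h) (hV.a₁_pos x y h) fun t ht =>
    (le_add_of_nonneg_right (abs_nonneg _)).trans (hV.log_deriv_le x y h t ht)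

theorem edgeWeight_antitoneOn (hV : c.V1 R T) (hA : c.Admissible R T)
    {e : (ℕ × ℕ) ⊕ (ℕ × ℕ)} (he : e ∈ G.edges) :
    AntitoneOn (fun t => c.edgeWeight G t e) (Set.Icc 0 T) := by
  rcases e with e | e
  · exact p₁_antitoneOn hV hA (SpaceGrid.mem_of_inl_mem_edges he)
  · exact p₂_antitoneOn hV hA (SpaceGrid.mem_of_inr_mem_edges he)

variable {K : Bounds}

theorem min_le_edgeWeight (hV : c.V1 R T) (hA : c.Admissible R T) (hB : c.BoundedBy R T K)
    {e : (ℕ × ℕ) ⊕ (ℕ × ℕ)} (he : e ∈ G.edges) {t : ℝ} (ht : t ∈ Set.Icc 0 T) :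
    min K.lo₁ K.lo₂ ≤ c.edgeWeight G t e := by
  rcases e with e | e
  · have hm := SpaceGrid.mem_of_inl_mem_edges he
    have h := (hB.p₁_mem _ _ hm t ht).1
    rw [abs_of_pos (p₁_pos hV hA hm ht)] at h
    exact (min_le_left _ _).trans h
  · have hm := SpaceGrid.mem_of_inr_mem_edges he
    have h := (hB.p₂_mem _ _ hm t ht).1
    rw [abs_of_pos (p₂_pos hV hA hm ht)] at h
    exact (min_le_right _ _).trans h

theorem edgeWeight_le_max (hB : c.BoundedBy R T K)
    {e : (ℕ × ℕ) ⊕ (ℕ × ℕ)} (he : e ∈ G.edges) {t : ℝ} (ht : t ∈ Set.Icc 0 T) :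
    |c.edgeWeight G t e| ≤ max K.hi₁ K.hi₂ := by
  rcases e with e | e
  · exact (hB.p₁_mem _ _ (SpaceGrid.mem_of_inl_mem_edges he) t ht).2.trans (le_max_left _ _)
  · exact (hB.p₂_mem _ _ (SpaceGrid.mem_of_inr_mem_edges he) t ht).2.trans (le_max_right _ _)

end Coefficients

end Alikhanov

/-! ### The energy estimate in space -/

namespace Alikhanov

namespace Coefficients

variable {R : Rectangle} {c : Coefficients} {G : SpaceGrid R} {T : ℝ} {K : Bounds}

/-- The bound of the lower order terms in the energy estimate, from Young's inequality and the
discrete Poincaré inequality. -/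
noncomputable def Bounds.lowerOrder (K : Bounds) (R : Rectangle) : ℝ :=
  3 / 4 * |K.hi₀| * (K.hi₃ ^ 2 + K.hi₄ ^ 2 + K.hiB ^ 2 * (R.xr - R.xl) ^ 2)

theorem Bounds.lowerOrder_nonneg (K : Bounds) (R : Rectangle) : 0 ≤ K.lowerOrder R := by
  unfold lowerOrder
  positivity

/-- The lower order terms of the discrete elliptic operator. -/
noncomputable def lowerOrderOp (c : Coefficients) (G : SpaceGrid R) (t : ℝ) (v : ℕ → ℕ → ℝ)
    (i j : ℕ) : ℝ :=
  c.p₃ (G.x i) (G.y j) t * G.δxhat v i j + c.p₄ (G.x i) (G.y j) t * G.δyhat v i j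
    + c.b₃ (G.x i) (G.y j) t * v i j

theorem discreteOp_eq (t : ℝ) (v : ℕ → ℕ → ℝ) (i j : ℕ) :
    c.discreteOp G t v i j
      = (c.p (G.x i) (G.y j) t)⁻¹ * c.divGrad G t v i j + c.lowerOrderOp G t v i j := by
  unfold discreteOp divGrad lowerOrderOp
  ring

theorem lowerOrderOp_sq_le (hB : c.BoundedBy R T K) {t : ℝ} (ht : t ∈ Set.Icc 0 T)
    (v : ℕ → ℕ → ℝ) {i j : ℕ} (h : G.Interior i j) :
    c.lowerOrderOp G t v i j ^ 2 ≤ 3 * (K.hi₃ ^ 2 * G.δxhat v i j ^ 2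
      + K.hi₄ ^ 2 * G.δyhat v i j ^ 2 + K.hiB ^ 2 * v i j ^ 2) := by
  have hm := G.mem_of_interior h
  have hsq : ∀ {a b : ℝ} (s : ℝ), |a| ≤ b → (a * s) ^ 2 ≤ b ^ 2 * s ^ 2 := by
    intro a b s hab
    rw [mul_pow]
    exact mul_le_mul_of_nonneg_right (sq_le_sq.2 (hab.trans (le_abs_self b))) (sq_nonneg s)
  have h3 := hsq (G.δxhat v i j) (hB.p₃_le _ _ hm t ht)
  have h4 := hsq (G.δyhat v i j) (hB.p₄_le _ _ hm t ht)
  have h5 := hsq (v i j) (hB.b₃_le _ _ hm t ht)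
  unfold lowerOrderOp
  generalize c.p₃ (G.x i) (G.y j) t * G.δxhat v i j = a at *
  generalize c.p₄ (G.x i) (G.y j) t * G.δyhat v i j = b at *
  generalize c.b₃ (G.x i) (G.y j) t * v i j = d at *
  nlinarith [sq_nonneg (a - b), sq_nonneg (b - d), sq_nonneg (a - d)]

theorem sum_lowerOrderOp_sq_le (hB : c.BoundedBy R T K) {t : ℝ} (ht : t ∈ Set.Icc 0 T)
    {v : ℕ → ℕ → ℝ} (hv : G.VanishesOnBoundary v) :
    G.hx * G.hy * ∑ q ∈ G.interior, |K.hi₀| / 4 * c.lowerOrderOp G t v q.1 q.2 ^ 2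
      ≤ K.lowerOrder R * G.normGrad v ^ 2 := by
  have h : ∑ q ∈ G.interior, |K.hi₀| / 4 * c.lowerOrderOp G t v q.1 q.2 ^ 2
      ≤ ∑ q ∈ G.interior, 3 / 4 * |K.hi₀| * (K.hi₃ ^ 2 * G.δxhat v q.1 q.2 ^ 2
        + K.hi₄ ^ 2 * G.δyhat v q.1 q.2 ^ 2 + K.hiB ^ 2 * v q.1 q.2 ^ 2) := by
    refine Finset.sum_le_sum fun q hq => ?_
    have := mul_le_mul_of_nonneg_left
      (lowerOrderOp_sq_le hB ht v (G.mem_interior.1 hq)) (abs_nonneg K.hi₀)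
    linarith
  refine (mul_le_mul_of_nonneg_left h G.area_nonneg).trans ?_
  rw [← Finset.mul_sum, Finset.sum_add_distrib, Finset.sum_add_distrib, ← Finset.mul_sum,
    ← Finset.mul_sum, ← Finset.mul_sum]
  have h3 := mul_le_mul_of_nonneg_left (G.sum_δxhat_sq_le v) (sq_nonneg K.hi₃)
  have h4 := mul_le_mul_of_nonneg_left (G.sum_δyhat_sq_le v) (sq_nonneg K.hi₄)
  have h5 := mul_le_mul_of_nonneg_left hv.sum_sq_le (sq_nonneg K.hiB)
  have := mul_le_mul_of_nonneg_left (add_le_add (add_le_add h3 h4) h5)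
    (by positivity : 0 ≤ 3 / 4 * |K.hi₀|)
  unfold Bounds.lowerOrder
  linarith

theorem sum_edges_mul_le {H : ℝ} {w : (ℕ × ℕ) ⊕ (ℕ × ℕ) → ℝ}
    (hw : ∀ e ∈ G.edges, |w e| ≤ H) (v f : ℕ → ℕ → ℝ) (hH : 0 ≤ H) :
    G.hx * G.hy * ∑ e ∈ G.edges, w e * (G.grad v e * G.grad f e)
      ≤ H * (G.normGrad v * G.normGrad f) := by
  have h1 : ∑ e ∈ G.edges, w e * (G.grad v e * G.grad f e)
      ≤ H * ∑ e ∈ G.edges, |G.grad v e| * |G.grad f e| := by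
    rw [Finset.mul_sum]
    refine Finset.sum_le_sum fun e he => (le_abs_self _).trans ?_
    rw [abs_mul, abs_mul]
    exact mul_le_mul_of_nonneg_right (hw e he) (by positivity)
  have h2 : G.hx * G.hy * ∑ e ∈ G.edges, |G.grad v e| * |G.grad f e|
      ≤ G.normGrad v * G.normGrad f := by
    refine abs_le_of_sq_le_sq' ?_ (mul_nonneg (G.normGrad_nonneg v) (G.normGrad_nonneg f)) |>.2
    rw [mul_pow, mul_pow (G.normGrad v), G.normGrad_sq, G.normGrad_sq]
    have h := Finset.sum_mul_sq_le_sq_mul_sq G.edges (fun e => |G.grad v e|)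
      fun e => |G.grad f e|
    simp only [sq_abs] at h
    nlinarith [mul_le_mul_of_nonneg_left h (sq_nonneg (G.hx * G.hy))]
  have h3 := mul_le_mul_of_nonneg_left h1 G.area_nonneg
  have h4 := mul_le_mul_of_nonneg_left h2 hH
  linarith

/-- The energy estimate: the equation `g = 𝒜_h v + f` tested with the second order part
`δ_x [p₁ δ_x v] + δ_y [p₂ δ_y v]`. The term `p⁻¹ (δ_x [p₁ δ_x v] + δ_y [p₂ δ_y v])^2` absorbs
the lower order terms, and `f`, which vanishes on the boundary, is treated by summation
by parts. -/
theorem sum_edgeWeight_mul_grad_le (hV : c.V1 R T) (hA : c.Admissible R T)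
    (hB : c.BoundedBy R T K) {t : ℝ} (ht : t ∈ Set.Icc 0 T) {v g f : ℕ → ℕ → ℝ}
    (hv : G.VanishesOnBoundary v) (hg : G.VanishesOnBoundary g) (hf : G.VanishesOnBoundary f)
    (heq : ∀ i j, G.Interior i j → g i j = c.discreteOp G t v i j + f i j) {H : ℝ} (hH : 0 ≤ H)
    (hKH : max K.hi₁ K.hi₂ ≤ H) :
    G.hx * G.hy * ∑ e ∈ G.edges, c.edgeWeight G t e * (G.grad v e * G.grad g e)
      ≤ K.lowerOrder R * G.normGrad v ^ 2 + H * (G.normGrad v * G.normGrad f) := by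
  have hpt : ∀ q ∈ G.interior, -(g q.1 q.2 * c.divGrad G t v q.1 q.2)
      ≤ |K.hi₀| / 4 * c.lowerOrderOp G t v q.1 q.2 ^ 2
        + -(f q.1 q.2 * c.divGrad G t v q.1 q.2) := by
    intro q hq
    have hq' := G.mem_interior.1 hq
    have hm := G.mem_of_interior hq'
    have hp := p_pos hV hA hm ht
    have hp2 := (hB.p_mem _ _ hm t ht).2
    rw [abs_of_pos hp] at hp2
    have hp3 := hp2.trans (le_abs_self _)
    rw [heq _ _ hq', discreteOp_eq]
    generalize c.divGrad G t v q.1 q.2 = L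
    generalize c.lowerOrderOp G t v q.1 q.2 = r
    generalize c.p (G.x q.1) (G.y q.2) t = p at *
    have h1 : 0 ≤ p⁻¹ * (L + p * r / 2) ^ 2 := by positivity
    have h2 : p⁻¹ * (L + p * r / 2) ^ 2 = p⁻¹ * L * L + r * L + p / 4 * r ^ 2 := by
      field_simp
      ring
    nlinarith [mul_le_mul_of_nonneg_right hp3 (sq_nonneg r)]
  have hsum := mul_le_mul_of_nonneg_left (Finset.sum_le_sum hpt) G.area_nonneg
  rw [Finset.sum_add_distrib, Finset.sum_neg_distrib, Finset.sum_neg_distrib,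
    c.sum_mul_divGrad t v hg, c.sum_mul_divGrad t v hf, neg_neg, neg_neg, mul_add] at hsum
  have h1 := sum_lowerOrderOp_sq_le hB ht hv
  have h2 := sum_edges_mul_le (G := G) (fun e he => (edgeWeight_le_max hB he ht).trans hKH) v f hH
  linarith

end Coefficients

/-! ### The energy inequality in time -/

namespace SpaceGrid

variable {R : Rectangle} {G : SpaceGrid R}

theorem grad_linear (s r : ℝ) (u v : ℕ → ℕ → ℝ) (e : (ℕ × ℕ) ⊕ (ℕ × ℕ)) :
    G.grad (fun i j => s * u i j + r * v i j) e = s * G.grad u e + r * G.grad v e := by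
  rcases e with e | e
  · simp only [grad, δx]
    ring
  · simp only [grad, δy]
    ring

theorem grad_caputo {T : ℝ} (m : TimeMesh T) (β : ℝ) (u : ℕ → ℕ → ℕ → ℝ) (n : ℕ)
    (e : (ℕ × ℕ) ⊕ (ℕ × ℕ)) :
    G.grad (fun i j => m.caputo β (fun k => u k i j) n) e
      = m.caputo β (fun k => G.grad (u k) e) n := by
  rcases e with e | e
  · simp only [grad, δx, TimeMesh.caputo]
    rw [← Finset.sum_sub_distrib, Finset.sum_div]
    refine Finset.sum_congr rfl fun k _ => ?_
    ring
  · simp only [grad, δy, TimeMesh.caputo]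
    rw [← Finset.sum_sub_distrib, Finset.sum_div]
    refine Finset.sum_congr rfl fun k _ => ?_
    ring

theorem normGrad_sq_combination_le {θ : ℝ} (h0 : 0 ≤ θ) (h1 : θ ≤ 1) (u v : ℕ → ℕ → ℝ) :
    G.normGrad (fun i j => (1 - θ) * u i j + θ * v i j) ^ 2
      ≤ (1 - θ) * G.normGrad u ^ 2 + θ * G.normGrad v ^ 2 := by
  have h : ∑ e ∈ G.edges, G.grad (fun i j => (1 - θ) * u i j + θ * v i j) e ^ 2
      ≤ (1 - θ) * ∑ e ∈ G.edges, G.grad u e ^ 2 + θ * ∑ e ∈ G.edges, G.grad v e ^ 2 := by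
    rw [Finset.mul_sum, Finset.mul_sum, ← Finset.sum_add_distrib]
    refine Finset.sum_le_sum fun e _ => ?_
    rw [grad_linear]
    nlinarith [mul_nonneg (mul_nonneg h0 (sub_nonneg.2 h1)) (sq_nonneg (G.grad u e - G.grad v e))]
  rw [normGrad_sq, normGrad_sq, normGrad_sq]
  have := mul_le_mul_of_nonneg_left h G.area_nonneg
  linarith

end SpaceGrid

/-- The discrete energy `h_x h_y ∑_e w_e (∇_h u)_e^2` weighted by the diffusion coefficients at
time `t`. -/
noncomputable def energy {R : Rectangle} (c : Coefficients) (G : SpaceGrid R) (t : ℝ)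
    (u : ℕ → ℕ → ℝ) : ℝ :=
  G.hx * G.hy * ∑ e ∈ G.edges, c.edgeWeight G t e * G.grad u e ^ 2

section Energy

variable {R : Rectangle} {c : Coefficients} {G : SpaceGrid R} {T : ℝ}
  {K : Coefficients.Bounds} {m : TimeMesh T} {α : ℝ}

open Coefficients SpaceGrid

theorem min_mul_normGrad_sq_le_energy (hV : c.V1 R T) (hA : c.Admissible R T)
    (hB : c.BoundedBy R T K) {t : ℝ} (ht : t ∈ Set.Icc 0 T) (u : ℕ → ℕ → ℝ) :
    min K.lo₁ K.lo₂ * G.normGrad u ^ 2 ≤ energy c G t u := by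
  rw [normGrad_sq, energy, mul_left_comm, Finset.mul_sum (s := G.edges)]
  refine mul_le_mul_of_nonneg_left (Finset.sum_le_sum fun e he => ?_) G.area_nonneg
  exact mul_le_mul_of_nonneg_right (min_le_edgeWeight hV hA hB he ht) (sq_nonneg _)

theorem energy_le (hB : c.BoundedBy R T K) {t : ℝ} (ht : t ∈ Set.Icc 0 T) (u : ℕ → ℕ → ℝ) {H : ℝ}
    (hKH : max K.hi₁ K.hi₂ ≤ H) : energy c G t u ≤ H * G.normGrad u ^ 2 := by
  rw [normGrad_sq, energy, mul_left_comm, Finset.mul_sum (a := H)]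
  refine mul_le_mul_of_nonneg_left (Finset.sum_le_sum fun e he => ?_) G.area_nonneg
  exact mul_le_mul_of_nonneg_right
    ((le_abs_self _).trans ((edgeWeight_le_max hB he ht).trans hKH)) (sq_nonneg _)

theorem TimeMesh.tθ_mem (hα : α ∈ Set.Ioo (0 : ℝ) 1) {n : ℕ} (hn : n ≤ m.N) :
    m.tθ α n ∈ Set.Icc 0 T := by
  refine ⟨?_, (tθ_le hα hn).trans ((t_mono hn le_rfl).trans m.t_last.le)⟩
  have h1 := t_nonneg (m := m) hn
  have h2 := t_nonneg (m := m) (show n - 1 ≤ m.N by omega)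
  unfold tθ
  nlinarith [hα.1, hα.2, mul_nonneg hα.1.le h2, mul_nonneg (sub_nonneg.2 hα.2.le) h1]

theorem TimeMesh.tθ_mono (hα : α ∈ Set.Ioo (0 : ℝ) 1) {k n : ℕ} (hkn : k ≤ n) (hn : n ≤ m.N) :
    m.tθ α k ≤ m.tθ α n := by
  rcases hkn.eq_or_lt with rfl | h
  · rfl
  · exact (tθ_le hα (hkn.trans hn)).trans (lt_tθ_of_lt hα h hn).le

/-- Since the weights decrease in time, the energies at the off-set times `t_{k-θ}` (with
`t_{0-θ} = 0`, as `TimeMesh.tθ` reads `t_{-1}` as `t₀`) satisfy a differential inequality in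
discrete form. -/
theorem caputo_energy_le (hα : α ∈ Set.Ioo (0 : ℝ) 1)
    (hρ : ∀ k, 1 ≤ k → k + 1 ≤ m.N → m.ρ k ≤ 7 / 4) (hV : c.V1 R T) (hA : c.Admissible R T)
    {n : ℕ} (h1 : 1 ≤ n) (hn : n ≤ m.N) (hlo : ∀ e ∈ G.edges, 0 ≤ c.edgeWeight G (m.tθ α n) e)
    (u : ℕ → ℕ → ℕ → ℝ) :
    m.caputo α (fun k => energy c G (m.tθ α k) (u k)) n
      ≤ 2 * (G.hx * G.hy * ∑ e ∈ G.edges, c.edgeWeight G (m.tθ α n) e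
        * (G.grad (fun i j => (1 - α / 2) * u n i j + α / 2 * u (n - 1) i j) e
          * G.grad (fun i j => m.caputo α (fun k => u k i j) n) e)) := by
  have e1 : m.caputo α (fun k => energy c G (m.tθ α k) (u k)) n
      = G.hx * G.hy * ∑ e ∈ G.edges,
        m.caputo α (fun k => c.edgeWeight G (m.tθ α k) e * G.grad (u k) e ^ 2) n := by
    simp only [TimeMesh.caputo, energy]
    rw [Finset.sum_comm, Finset.mul_sum]
    refine Finset.sum_congr rfl fun k _ => ?_
    rw [← mul_sub, ← Finset.sum_sub_distrib, mul_left_comm, Finset.mul_sum (s := G.edges)]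
  rw [e1, mul_left_comm 2, Finset.mul_sum (a := (2 : ℝ))]
  refine mul_le_mul_of_nonneg_left (Finset.sum_le_sum fun e he => ?_) G.area_nonneg
  rw [grad_linear, grad_caputo]
  have h2 := TimeMesh.caputo_weight_le hα hρ h1 hn (w := fun k => c.edgeWeight G (m.tθ α k) e)
    (g := fun k => G.grad (u k) e ^ 2)
    (fun k hk => edgeWeight_antitoneOn hV hA he (TimeMesh.tθ_mem hα (hk.trans hn))
      (TimeMesh.tθ_mem hα hn) (TimeMesh.tθ_mono hα hk hn)) fun k => sq_nonneg _
  have h3 := mul_le_mul_of_nonneg_left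
    (TimeMesh.half_caputo_sq_le hα hρ h1 hn fun k => G.grad (u k) e) (hlo e he)
  linarith

theorem TimeMesh.caputo_congr {g g' : ℕ → ℝ} {n : ℕ} (h : ∀ k ≤ n, g k = g' k) (β : ℝ) :
    m.caputo β g n = m.caputo β g' n := by
  unfold caputo
  refine Finset.sum_congr rfl fun k hk => ?_
  rw [Finset.mem_Icc] at hk
  rw [h k hk.2, h (k - 1) (by omega)]

/-- The bound of a solution by its initial value and any majorant `M` of the convolutions of the
complementary kernels with the data; `H` is an upper bound of the diffusion coefficients. -/
theorem IsDiscreteSolution.normGrad_le (hα : α ∈ Set.Ioo (0 : ℝ) 1)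
    (hρ : ∀ k, 1 ≤ k → k + 1 ≤ m.N → m.ρ k ≤ 7 / 4) (hV : c.V1 R T) (hA : c.Admissible R T)
    (hB : c.BoundedBy R T K) {f : ℝ → ℝ → ℝ → ℝ} {φ : ℝ → ℝ → ℝ} {u : ℕ → ℕ → ℕ → ℝ}
    (hu : IsDiscreteSolution α c f φ m G u) {H lo μ : ℝ} (hH : 0 ≤ H)
    (hKH : max K.hi₁ K.hi₂ ≤ H) (hlo : lo = min K.lo₁ K.lo₂) (hμ : 0 < μ)
    (hΛμ : 6 * (2 * K.lowerOrder R / lo) ≤ ω (1 - α) (1 / μ))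
    (hτ : ∀ k, 1 ≤ k → k ≤ m.N → m.τ k ≤ 1 / (2 * μ)) {n : ℕ} (hn : n ≤ m.N) {M : ℝ}
    (hM : 0 ≤ M)
    (hFM : ∀ k, 1 ≤ k → k ≤ n → ∑ j ∈ Finset.Icc 1 k, m.P α k j *
      G.normGrad (G.restrict fun x y => f x y (m.tθ α j)) ≤ M) :
    G.normGrad (u n) ≤ 2 * Real.exp (μ * m.t n / 2) / √lo
      * (√H * G.normGrad (u 0) + 2 * H / √lo * M) := by
  have hlo0 : 0 < lo := hlo ▸ lt_min K.lo₁_pos K.lo₂_pos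
  have hs : 0 < √lo := Real.sqrt_pos.2 hlo0
  set W : ℕ → ℝ := fun k => energy c G (m.tθ α k) (u k) with hW
  have hWlo : ∀ k ≤ m.N, lo * G.normGrad (u k) ^ 2 ≤ W k := fun k hk =>
    hlo ▸ min_mul_normGrad_sq_le_energy hV hA hB (TimeMesh.tθ_mem hα hk) (u k)
  have hW0 : ∀ k ≤ m.N, 0 ≤ W k := fun k hk =>
    (mul_nonneg hlo0.le (sq_nonneg _)).trans (hWlo k hk)
  have hgrad : ∀ k ≤ m.N, G.normGrad (u k) ≤ √(W k) / √lo := by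
    intro k hk
    rw [le_div_iff₀ hs]
    refine Real.le_sqrt_of_sq_le ?_
    rw [mul_pow, Real.sq_sqrt hlo0.le, mul_comm]
    exact hWlo k hk
  have hinit : √(W 0) ≤ √H * G.normGrad (u 0) := by
    rw [Real.sqrt_le_left (mul_nonneg (Real.sqrt_nonneg _) (G.normGrad_nonneg _)), mul_pow,
      Real.sq_sqrt hH]
    exact energy_le hB (TimeMesh.tθ_mem hα (Nat.zero_le _)) (u 0) hKH
  have hmain : √(W n) ≤ 2 * Real.exp (μ * m.t n / 2) * (√(W 0) + 2 * H / √lo * M) := by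
    refine TimeMesh.le_of_caputo_sq_le hα hρ hμ
      (div_nonneg (mul_nonneg zero_le_two (K.lowerOrder_nonneg R)) hlo0.le) hΛμ hτ hn
      (y := fun k => √(W k)) (F := fun j => 2 * H / √lo *
        G.normGrad (G.restrict fun x y => f x y (m.tθ α j)))
      (fun k => Real.sqrt_nonneg _)
      (fun k => mul_nonneg (by positivity) (G.normGrad_nonneg _)) (by positivity) ?_ ?_
    · intro j h1 hj
      have hjN := hj.trans hn
      have ht := TimeMesh.tθ_mem (m := m) hα hjN
      set v : ℕ → ℕ → ℝ := fun i' j' => (1 - α / 2) * u j i' j' + α / 2 * u (j - 1) i' j' with hv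
      have hvB : G.VanishesOnBoundary v := by
        intro i' j' hi' hj' hI
        simp only [hv]
        rw [hu.boundary j hjN i' j' hi' hj' hI, hu.boundary (j - 1) (by omega) i' j' hi' hj' hI]
        ring
      have hgB : G.VanishesOnBoundary (fun i' j' => m.caputo α (fun k => u k i' j') j) := by
        intro i' j' hi' hj' hI
        refine (TimeMesh.caputo_congr (g' := fun _ => 0)
          (fun k hk => hu.boundary k (hk.trans hjN) i' j' hi' hj' hI) α).trans ?_
        simp [TimeMesh.caputo]
      have hspace := sum_edgeWeight_mul_grad_le hV hA hB ht hvB hgB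
        (vanishesOnBoundary_restrict fun x y => f x y (m.tθ α j))
        (fun i' j' hI => by
          rw [hu.equation j h1 hjN i' j' hI, restrict, if_pos hI]) hH hKH
      have htime := caputo_energy_le (G := G) hα hρ hV hA h1 hjN
        (fun e he => hlo0.le.trans (hlo ▸ min_le_edgeWeight hV hA hB he ht)) u
      rw [TimeMesh.caputo_congr (g' := W)
        (fun k hk => Real.sq_sqrt (hW0 k (hk.trans hjN))) α]
      set y := max √(W j) √(W (j - 1)) with hy
      have hy0 : 0 ≤ y := (Real.sqrt_nonneg _).trans (le_max_left _ _)
      have hvy : G.normGrad v ≤ y / √lo := by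
        have hpair : ∀ k ≤ m.N, √(W k) ≤ y → G.normGrad (u k) ^ 2 ≤ (y / √lo) ^ 2 :=
          fun k hk hky => pow_le_pow_left₀ (G.normGrad_nonneg _)
            ((hgrad k hk).trans (div_le_div_of_nonneg_right hky hs.le)) 2
        have ha := hpair j hjN (le_max_left _ _)
        have hb := hpair (j - 1) (by omega) (le_max_right _ _)
        refine abs_le_of_sq_le_sq' ?_ (by positivity) |>.2
        have hθ0 : 0 ≤ α / 2 := by linarith [hα.1]
        have hθ1 : α / 2 ≤ 1 := by linarith [hα.2]
        refine (normGrad_sq_combination_le hθ0 hθ1 (u j) (u (j - 1))).trans ?_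
        nlinarith [mul_le_mul_of_nonneg_left ha (sub_nonneg.2 hθ1),
          mul_le_mul_of_nonneg_left hb hθ0]
      have hv0 := G.normGrad_nonneg v
      have hvsq : G.normGrad v ^ 2 ≤ y ^ 2 / lo := by
        have := pow_le_pow_left₀ hv0 hvy 2
        rwa [div_pow, Real.sq_sqrt hlo0.le] at this
      have hf0 := G.normGrad_nonneg (G.restrict fun x y => f x y (m.tθ α j))
      generalize G.normGrad (G.restrict fun x y => f x y (m.tθ α j)) = F at *
      have ha := mul_le_mul_of_nonneg_left hvsq (K.lowerOrder_nonneg R)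
      have hb := mul_le_mul_of_nonneg_left (mul_le_mul_of_nonneg_right hvy hf0) hH
      have e : 2 * K.lowerOrder R / lo * y ^ 2 + y * (2 * H / √lo * F)
          = 2 * (K.lowerOrder R * (y ^ 2 / lo) + H * (y / √lo * F)) := by
        ring
      rw [e]
      linarith
    · intro k h1 hk
      refine le_trans (le_of_eq ?_)
        (mul_le_mul_of_nonneg_left (hFM k h1 hk) (by positivity : 0 ≤ 2 * H / √lo))
      rw [Finset.mul_sum]
      refine Finset.sum_congr rfl fun j _ => ?_
      ring
  refine (hgrad n hn).trans ?_
  rw [div_le_iff₀ hs]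
  have e : 2 * Real.exp (μ * m.t n / 2) / √lo * (√H * G.normGrad (u 0) + 2 * H / √lo * M) * √lo
      = 2 * Real.exp (μ * m.t n / 2) * (√H * G.normGrad (u 0) + 2 * H / √lo * M) := by
    field_simp
  rw [e]
  exact hmain.trans (mul_le_mul_of_nonneg_left (by linarith) (by positivity))

end Energy

end Alikhanov

theorem theorem3p1 (α : ℝ) (hα : α ∈ Set.Ioo (0 : ℝ) 1)
    (R : Alikhanov.Rectangle) (K : Alikhanov.Coefficients.Bounds) :
    ∃ τ₀ : ℝ, 0 < τ₀ ∧ ∀ T : ℝ, 0 < T → ∃ C₁ C₂ : ℝ, 0 < C₁ ∧ 0 < C₂ ∧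
      ∀ c : Alikhanov.Coefficients, c.V1 R T → c.Admissible R T → c.BoundedBy R T K →
      ∀ (f : ℝ → ℝ → ℝ → ℝ) (φ : ℝ → ℝ → ℝ) (G : Alikhanov.SpaceGrid R)
        (m : Alikhanov.TimeMesh T),
        (∀ k, 1 ≤ k → k + 1 ≤ m.N → m.ρ k ≤ 7 / 4) →
        (∀ k, 1 ≤ k → k ≤ m.N → m.τ k ≤ τ₀) →
        ∀ u : ℕ → ℕ → ℕ → ℝ, Alikhanov.IsDiscreteSolution α c f φ m G u →
        ∀ (n : ℕ) (hn : 1 ≤ n), n ≤ m.N →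
          G.normGrad (u n)
            ≤ C₁ * (G.normGrad (u 0)
                + (Finset.Icc 1 n).sup' (Finset.nonempty_Icc.2 hn) (fun k =>
                    ∑ j ∈ Finset.Icc 1 k, m.P α k j *
                      G.normGrad (G.restrict (fun x y => f x y (m.tθ α j)))))
          ∧ C₁ * (G.normGrad (u 0)
                + (Finset.Icc 1 n).sup' (Finset.nonempty_Icc.2 hn) (fun k =>
                    ∑ j ∈ Finset.Icc 1 k, m.P α k j *
                      G.normGrad (G.restrict (fun x y => f x y (m.tθ α j)))))
            ≤ C₂ * (G.normGrad (u 0)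
                + (Finset.Icc 1 n).sup' (Finset.nonempty_Icc.2 hn) (fun k =>
                    m.t k ^ α *
                      G.normGrad (G.restrict (fun x y => f x y (m.tθ α k))))) := by
  obtain ⟨lo, hlo⟩ : ∃ lo, lo = min K.lo₁ K.lo₂ := ⟨_, rfl⟩
  have hlo0 : 0 < lo := hlo ▸ lt_min K.lo₁_pos K.lo₂_pos
  obtain ⟨H, hH⟩ : ∃ H, H = max 1 (max K.hi₁ K.hi₂) := ⟨_, rfl⟩
  have hH0 : 0 < H := hH ▸ zero_lt_one.trans_le (le_max_left _ _)
  have hKH : max K.hi₁ K.hi₂ ≤ H := hH ▸ le_max_right _ _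
  have hΛ : 0 ≤ 2 * K.lowerOrder R / lo :=
    div_nonneg (mul_nonneg zero_le_two (K.lowerOrder_nonneg R)) hlo0.le
  obtain ⟨μ, hμ, hμΛ⟩ := Alikhanov.exists_le_ω hα
    (by linarith : 0 < 6 * (2 * K.lowerOrder R / lo) + 1)
  have hΓ := Alikhanov.gamma_one_sub_pos hα
  have hs : 0 < √lo := Real.sqrt_pos.2 hlo0
  have hsH : 0 < √H := Real.sqrt_pos.2 hH0
  refine ⟨1 / (2 * μ), by positivity, fun T hT => ?_⟩
  set C₁ := 2 * Real.exp (μ * T / 2) / √lo * (√H + 2 * H / √lo) with hC₁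
  have hC₁0 : 0 < C₁ := by positivity
  refine ⟨C₁, C₁ * (1 + Real.Gamma (1 - α)), hC₁0, by positivity, ?_⟩
  intro c hV hA hB f φ G m hρ hτ u hu n hn hnN
  set F : ℕ → ℝ := fun j => G.normGrad (G.restrict (fun x y => f x y (m.tθ α j))) with hF
  have hF0 : ∀ j, 0 ≤ F j := fun j => G.normGrad_nonneg _
  set M := (Finset.Icc 1 n).sup' (Finset.nonempty_Icc.2 hn) (fun k =>
    ∑ j ∈ Finset.Icc 1 k, m.P α k j * F j) with hM
  set M' := (Finset.Icc 1 n).sup' (Finset.nonempty_Icc.2 hn) (fun k => m.t k ^ α * F k) with hM'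
  have hFM : ∀ k, 1 ≤ k → k ≤ n → ∑ j ∈ Finset.Icc 1 k, m.P α k j * F j ≤ M := fun k h1 hk =>
    Finset.le_sup' (fun k => ∑ j ∈ Finset.Icc 1 k, m.P α k j * F j) (Finset.mem_Icc.2 ⟨h1, hk⟩)
  have hFM' : ∀ k, 1 ≤ k → k ≤ n → m.t k ^ α * F k ≤ M' := fun k h1 hk =>
    Finset.le_sup' (fun k => m.t k ^ α * F k) (Finset.mem_Icc.2 ⟨h1, hk⟩)
  have hM0 : 0 ≤ M := by
    refine le_trans (Finset.sum_nonneg fun j hj => ?_) (hFM n hn le_rfl)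
    obtain ⟨h1, hj⟩ := Finset.mem_Icc.1 hj
    exact mul_nonneg (Alikhanov.TimeMesh.P_nonneg hα hρ hnN j h1 hj) (hF0 j)
  have hM'0 : 0 ≤ M' := le_trans (mul_nonneg
    (Real.rpow_nonneg (Alikhanov.TimeMesh.t_nonneg hnN) _) (hF0 n)) (hFM' n hn le_rfl)
  have hu0 := G.normGrad_nonneg (u 0)
  constructor
  · refine (hu.normGrad_le hα hρ hV hA hB hH0.le hKH hlo hμ (by linarith) hτ hnN hM0 hFM).trans ?_
    have ht : m.t n ≤ T := (Alikhanov.TimeMesh.t_mono hnN le_rfl).trans m.t_last.le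
    have he : Real.exp (μ * m.t n / 2) ≤ Real.exp (μ * T / 2) :=
      Real.exp_le_exp.2 (by linarith [mul_le_mul_of_nonneg_left ht hμ.le])
    have h2 : √H * G.normGrad (u 0) + 2 * H / √lo * M
        ≤ (√H + 2 * H / √lo) * (G.normGrad (u 0) + M) := by
      have h3 : 0 ≤ 2 * H / √lo := by positivity
      nlinarith [mul_nonneg hsH.le hM0, mul_nonneg h3 hu0]
    rw [hC₁, mul_assoc (2 * Real.exp (μ * T / 2) / √lo)]
    gcongr
  · have hMM' : M ≤ Real.Gamma (1 - α) * M' := by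
      refine Finset.sup'_le _ _ fun k hk => ?_
      obtain ⟨h1, hkn⟩ := Finset.mem_Icc.1 hk
      have hkN := hkn.trans hnN
      have hP := Alikhanov.TimeMesh.sum_P_mul_ω_le (m := m) hα hρ h1 hkN
      have hΓM : 0 ≤ Real.Gamma (1 - α) * M' := mul_nonneg hΓ.le hM'0
      refine le_trans (Finset.sum_le_sum fun j hj => ?_) (?_ :
        ∑ j ∈ Finset.Icc 1 k, m.P α k j * Alikhanov.ω (1 - α) (m.t j) *
          (Real.Gamma (1 - α) * M') ≤ _)
      · obtain ⟨h1j, hjk⟩ := Finset.mem_Icc.1 hj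
        rw [mul_assoc]
        refine mul_le_mul_of_nonneg_left ?_
          (Alikhanov.TimeMesh.P_nonneg hα hρ hkN j h1j hjk)
        have htj := Alikhanov.TimeMesh.t_pos (m := m) h1j (hjk.trans hkN)
        have hω := Alikhanov.ω_pos hα htj
        have e : F j = Alikhanov.ω (1 - α) (m.t j) * (Real.Gamma (1 - α) * (m.t j ^ α * F j)) := by
          rw [Alikhanov.ω_one_sub, Real.rpow_neg htj.le]
          have := (Real.rpow_pos_of_pos htj α).ne'
          field_simp
        rw [e]
        exact mul_le_mul_of_nonneg_left (mul_le_mul_of_nonneg_left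
          (hFM' j h1j (hjk.trans hkn)) hΓ.le) hω.le
      · rw [← Finset.sum_mul]
        exact mul_le_of_le_one_left hΓM hP
    rw [mul_assoc C₁]
    refine mul_le_mul_of_nonneg_left ?_ hC₁0.le
    nlinarith [mul_nonneg hΓ.le hu0]
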